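/- **Definitions.** For $K\subset\mathbb N$ let $\delta_+(K)=\limsup_{n\to\infty}\frac{|K\cap\{1,\dots,n\}|}{n}$. For a real sequence $(x_n)_{n\ge1}$, $L\in\mathbb R$ and $A\subset\mathbb R$, the index of convergence to $L$, respectively relative to $A$, is $$i(x_n;L)=1-\sup_{\varepsilon>0}\delta_+\big(\{n: |x_n-L|\ge\varepsilon\}\big),\qquad i(x_n;A)=1-\sup_{\varepsilon>0}\delta_+\big(\{n: x_n\notin A+\,]-\varepsilon,\varepsilon[\,\}\big).$$ Let $L_nf$ be the Lagrange polynomial interpolating $f$ at the Chebyshev nodes $x_{n,k}=\cos\frac{(2k-1)\pi}{2n}$, $k=1,\dots,n$, that is $$L_nf(x)=\sum_{k=1}^n f(x_{n,k})\prod_{i\ne k}\frac{x-x_{n,i}}{x_{n,k}-x_{n,i}}.$$ For $0<x<1$ let $$g(x)=\frac{\sin(\pi x)}{\pi}\,J(1,x),\qquad J(s,x)=\sum_{n=0}^{\infty}\frac{(-1)^n}{(n+x)^s},$$ the series being the limit of its partial sums. A set $A\subset\mathbb R$ is Peano–Jordan measurable if, for every bounded interval $[a,b]$, the inner and outer Jordan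 contents of $A\cap[a,b]$ agree (for bounded $A$ this is the usual notion), and $|\cdot|$ denotes the Peano–Jordan measure. **Theorem.** Let $\theta_0\in\,]0,\pi[$, $x_0=\cos\theta_0\in\,]-1,1[$, $d\in\mathbb R$, and let $h(x)=0$ for $x<x_0$, $h(x_0)=d$, $h(x)=1$ for $x>x_0$ ($x\in[-1,1]$). Then $L_nh\to h$ uniformly on every compact subset of $[-1,1]\setminus\{x_0\}$. Moreover: i) Suppose $\theta_0/\pi=p/q$ with $p,q\in\mathbb N$, $q\ne0$, $\gcd(p,q)=1$. If $q$ is odd, then $$i\Big(L_nh(x_0);\,g\big(\tfrac{2m+1}{2q}\big)\Big)=\frac1q,\qquad m=0,\dots,q-1.$$ If $q$ is even, then $$i\big(L_nh(x_0);\,d\big)=\frac1q\quad\text{provided } d\ne g\big(\tfrac mq\big)\text{ for all } m=1,\dots,q-1,$$ and, for each $m\in\{1,\dots,q-1\}$ with $g(\tfrac mq)\neq d$, $$i\Big(L_nh(x_0);\,g\big(\tfrac mq\big)\Big)=\frac1q.$$ ii) If $\theta_0/\pi$ is irrational and $A\subset\mathbb R$ is Peano–Jordan measurable, then $g^{-1}(A)=\{x\in\,]0,1[\;:\;g(x)\in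 A\}$ is Peano–Jordan measurable and $$i\big(L_nh(x_0);A\big)=|g^{-1}(A)|.$$ -/

import Mathlib

open scoped Pointwise Topology

noncomputable section

namespace LagrangeIndex

/-! ### Density and index of convergence -/

/-- The upper density `δ₊(K) = limsup |K ∩ {1, …, n}| / n` of a set of natural numbers. -/
def upperDensity (K : Set ℕ) : ℝ :=
  Filter.limsup (fun n : ℕ => ((K ∩ Set.Icc 1 n).ncard : ℝ) / n) Filter.atTop

/-- The index of convergence of `(x n)`, `n ≥ 1`, to the real number `L`.
(The value `x 0` plays no role, since only indices in `{1, …, n}` are counted.) -/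
def convIndex (x : ℕ → ℝ) (L : ℝ) : ℝ :=
  1 - ⨆ ε : Set.Ioi (0 : ℝ),
    upperDensity {n | x n ∈ Set.Iic (L - (ε : ℝ)) ∪ Set.Ici (L + (ε : ℝ))}

/-- The index of convergence of `(x n)`, `n ≥ 1`, relative to a set `A`. -/
def setConvIndex (x : ℕ → ℝ) (A : Set ℝ) : ℝ :=
  1 - ⨆ ε : Set.Ioi (0 : ℝ), upperDensity {n | x n ∉ A + Set.Ioo (-(ε : ℝ)) (ε : ℝ)}

/-! ### Lagrange interpolation at the Chebyshev nodes -/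

/-- The Chebyshev nodes `x_{n,k} = cos ((2k - 1)π / (2n))`, `k = 1, …, n`. -/
def chebNode (n k : ℕ) : ℝ :=
  Real.cos ((2 * (k : ℝ) - 1) * Real.pi / (2 * (n : ℝ)))

/-- `L_n f (x) = ∑_{k=1}^n ℓ_{n,k}(x) f(x_{n,k})`. Only the values of `f` at points of `[-1,1]`
enter. -/
def lagrangeOp (n : ℕ) (f : ℝ → ℝ) (x : ℝ) : ℝ :=
  (Lagrange.interpolate (Finset.Icc 1 n) (chebNode n) (fun k => f (chebNode n k))).eval x

/-- The unit step at `x₀` with value `d` at `x₀`. -/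
def stepFn (x₀ d x : ℝ) : ℝ :=
  if x < x₀ then 0 else if x = x₀ then d else 1

/-! ### The alternating Lerch series -/

/-- `J(s, a) = ∑_{n ≥ 0} (-1)^n / (n + a)^s`, the sum being the limit of the partial sums: for
`0 < s ≤ 1` the series converges only conditionally. -/
def lerchJ (s a : ℝ) : ℝ :=
  Filter.limUnder Filter.atTop
    (fun N : ℕ => ∑ n ∈ Finset.range N, (-1 : ℝ) ^ n / ((n : ℝ) + a) ^ s)

/-- The limit defining `J(s, a)` exists for all `s > 0` and `a > 0`. -/
theorem tendsto_lerchJ {s a : ℝ} (hs : 0 < s) (ha : 0 < a) :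
    Filter.Tendsto (fun N : ℕ => ∑ n ∈ Finset.range N, (-1 : ℝ) ^ n / ((n : ℝ) + a) ^ s)
      Filter.atTop (𝓝 (lerchJ s a)) := by
  have hanti : Antitone (fun n : ℕ => (((n : ℝ) + a) ^ s)⁻¹) := by
    intro m n hmn
    have h1 : 0 < (m : ℝ) + a := by positivity
    have h2 : (m : ℝ) ≤ n := by exact_mod_cast hmn
    exact inv_anti₀ (Real.rpow_pos_of_pos h1 s)
      (Real.rpow_le_rpow h1.le (by linarith) hs.le)
  have hlim : Filter.Tendsto (fun n : ℕ => (((n : ℝ) + a) ^ s)⁻¹) Filter.atTop (𝓝 0) :=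
    ((tendsto_rpow_atTop hs).comp
      (Filter.tendsto_atTop_add_const_right _ a tendsto_natCast_atTop_atTop)).inv_tendsto_atTop
  have h := hanti.tendsto_alternating_series_of_tendsto_zero hlim
  simp only [← div_eq_mul_inv] at h
  exact tendsto_nhds_limUnder h

/-- `g(x) = (sin (πx) / π) J(1, x)`; used for `x ∈ ]0,1[` only. -/
def g (x : ℝ) : ℝ :=
  Real.sin (Real.pi * x) / Real.pi * lerchJ 1 x

/-- `g⁻¹(A)`, where `g` has domain `]0,1[`. -/
def gPreimage (A : Set ℝ) : Set ℝ :=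
  {x | x ∈ Set.Ioo (0 : ℝ) 1 ∧ g x ∈ A}

/-! ### Peano–Jordan measure on the line -/

/-- The outer Jordan content of a bounded set: the infimum of the total lengths of the finite
families of compact intervals that cover it. -/
def jordanOuter (A : Set ℝ) : ℝ :=
  sInf {s : ℝ | ∃ F : Finset (ℝ × ℝ), (∀ I ∈ F, I.1 ≤ I.2) ∧
    A ⊆ ⋃ I ∈ F, Set.Icc I.1 I.2 ∧ s = ∑ I ∈ F, (I.2 - I.1)}

/-- The inner Jordan content of a bounded set: the supremum of the total lengths of the finite
families of pairwise disjoint compact intervals that it contains. -/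
def jordanInner (A : Set ℝ) : ℝ :=
  sSup {s : ℝ | ∃ F : Finset (ℝ × ℝ), (∀ I ∈ F, I.1 ≤ I.2) ∧
    (F : Set (ℝ × ℝ)).PairwiseDisjoint (fun I => Set.Icc I.1 I.2) ∧
    (⋃ I ∈ F, Set.Icc I.1 I.2) ⊆ A ∧ s = ∑ I ∈ F, (I.2 - I.1)}

/-- Peano–Jordan measurability of a bounded or unbounded subset of the line: inside each bounded
interval the inner and the outer content agree. (For bounded `A` this is the equality of the inner
and the outer content of `A` itself.) -/
def IsJordanMeasurable (A : Set ℝ) : Prop :=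
  ∀ a b : ℝ, jordanInner (A ∩ Set.Icc a b) = jordanOuter (A ∩ Set.Icc a b)

/-- The Peano–Jordan measure of a bounded Peano–Jordan measurable set: the common value of its
inner and its outer content. -/
def jordanMeasure (A : Set ℝ) : ℝ := jordanOuter A

end LagrangeIndex

end

namespace LagrangeIndex

open Real Finset MeasureTheory

/-! ### Alternating sums of monotone sequences -/

/-! Everything rests on the explicit form of the interpolant, `lagrangeOp_eq_sum`: with nodes `cos
τ_k`, `L_n f(x)` is `T_n(x) / n` times the sum of `(-1)^k sin τ_k / (cos τ_k - x) f(cos τ_k)`. For a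
step function this is an alternating sum of a kernel that is monotone in `τ` away from its pole, so
it is bounded by twice the largest term.

Away from the jump the kernel is bounded by `1 / δ` on the nodes that matter, and the factor `1 / n`
gives uniform convergence (`abs_lagrangeOp_stepFn_sub_le`).

At the jump, write `n θ / π + 1 / 2 = N + t` with `0 ≤ t < 1`. If `t = 0`, the jump is a node and
the interpolant takes the value `d`. Otherwise the nodes to be summed lie at angular distances `u =
π (m + t) / n` from `θ`, and `T_n(cos θ) = (-1)^N sin (π t)`. The kernel is `1 / u` plus a bounded
monotone remainder; the main part sums to a partial sum of the series for `g t`, and the remainder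
costs `O(1/n)`. Hence the interpolants follow `g (phase θ n)` (`tendsto_lagrangeOp_stepFn_sub`), and
only the distribution of the phases is left.

The function `g` is continuous and decreases with slope at least `1 / (2π)` in absolute value
(`le_g_sub`). It is therefore injective, and its inverse is Lipschitz, so preimages of null sets are
null. If `θ / π = p / q`, the phase is periodic with period `q` and, `p` being invertible mod `q`,
takes each of its values on exactly one residue class, of density `1 / q`
(`convIndex_eq_of_periodic`). If `θ / π` is irrational, Weyl's theorem bounds from below the
proportion of phases in any open set (`le_proportion_phase_mem`). Applied to the preimages of the
interior of `A` and of the points far from `A`, it gives both inequalities, because Jordan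
measurability means a null frontier (`isJordanMeasurable_iff`). -/

/-- Peeling off the first term leaves `b 0 - S'`, where induction puts the shifted sum `S'` between
`0` and `b 1`. Monotonicity is asked only below `N`, since the sequences of interest are monotone
only on part of the nodes. -/
theorem alternating_sum_nonneg_le {b : ℕ → ℝ} {N : ℕ} (hb : ∀ i j, i ≤ j → j < N → b j ≤ b i)
    (h0 : ∀ i < N, 0 ≤ b i) :
    0 ≤ ∑ i ∈ range N, (-1 : ℝ) ^ i * b i ∧ (0 < N → ∑ i ∈ range N, (-1 : ℝ) ^ i * b i ≤ b 0) := by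
  induction N generalizing b with
  | zero => simp
  | succ N ih =>
    have hs : ∑ i ∈ range (N + 1), (-1 : ℝ) ^ i * b i
        = b 0 - ∑ i ∈ range N, (-1 : ℝ) ^ i * b (i + 1) := by
      rw [sum_range_succ']
      simp only [pow_succ, pow_zero, one_mul, mul_neg, mul_one, neg_mul, sum_neg_distrib]
      ring
    obtain ⟨h1, h2⟩ := ih (b := fun i => b (i + 1))
      (fun i j hij hj => hb _ _ (by omega) (by omega)) (fun i hi => h0 _ (by omega))
    rw [hs]
    refine ⟨?_, fun _ => by linarith⟩
    rcases Nat.eq_zero_or_pos N with rfl | hN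
    · simpa using h0 0 (by omega)
    · have := h2 hN
      have := hb 0 1 (by omega) (by omega)
      simp only [zero_add] at *
      linarith

/-- Terms of either sign are handled by adding the constant `C`: the alternating sum of `b + C` lies
in `[0, 2C]` and that of `C` in `[0, C]`. -/
theorem abs_alternating_sum_le_of_antitone {b : ℕ → ℝ} {N : ℕ} {C : ℝ}
    (hb : ∀ i j, i ≤ j → j < N → b j ≤ b i) (hC : ∀ i < N, |b i| ≤ C) (hC0 : 0 ≤ C) :
    |∑ i ∈ range N, (-1 : ℝ) ^ i * b i| ≤ 2 * C := by
  rcases Nat.eq_zero_or_pos N with rfl | hN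
  · simpa using hC0
  obtain ⟨h1, h2⟩ := alternating_sum_nonneg_le (b := fun i => b i + C) (N := N)
    (fun i j hij hj => by have := hb i j hij hj; linarith)
    (fun i hi => by have := abs_le.1 (hC i hi); linarith)
  obtain ⟨h3, h4⟩ := alternating_sum_nonneg_le (b := fun _ => C) (N := N)
    (fun i j hij hj => le_rfl) (fun i hi => hC0)
  have h2 := h2 hN
  have h4 := h4 hN
  have := abs_le.1 (hC 0 hN)
  simp only [mul_add, sum_add_distrib] at h1 h2
  rw [abs_le]
  constructor <;> linarith

theorem abs_alternating_sum_le_of_monotone {b : ℕ → ℝ} {N : ℕ} {C : ℝ}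
    (hb : ∀ i j, i ≤ j → j < N → b i ≤ b j) (hC : ∀ i < N, |b i| ≤ C) (hC0 : 0 ≤ C) :
    |∑ i ∈ range N, (-1 : ℝ) ^ i * b i| ≤ 2 * C := by
  have := abs_alternating_sum_le_of_antitone (b := fun i => - b i) (N := N) (C := C)
    (fun i j hij hj => neg_le_neg (hb i j hij hj)) (fun i hi => by simpa using hC i hi) hC0
  simpa [mul_neg, sum_neg_distrib] using this

theorem abs_alternating_sum_Ico_le_of_monotone {b : ℕ → ℝ} {m N : ℕ} {C : ℝ}
    (hb : ∀ i j, m ≤ i → i ≤ j → j < N → b i ≤ b j) (hC : ∀ i, m ≤ i → i < N → |b i| ≤ C)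
    (hC0 : 0 ≤ C) :
    |∑ i ∈ Ico m N, (-1 : ℝ) ^ i * b i| ≤ 2 * C := by
  rw [sum_Ico_eq_sum_range]
  simp only [pow_add, mul_assoc]
  rw [← mul_sum, abs_mul, abs_pow, abs_neg, abs_one, one_pow, one_mul]
  exact abs_alternating_sum_le_of_monotone (fun i j hij hj => hb _ _ (by omega) (by omega) (by omega))
    (fun i hi => hC _ (by omega) (by omega)) hC0

/-! ### The fundamental polynomials at the Chebyshev nodes -/

/-- The angles `(2k - 1)π / (2n)` of the Chebyshev nodes. -/
noncomputable def nodeAngle (n k : ℕ) : ℝ := (2 * (k : ℝ) - 1) * π / (2 * (n : ℝ))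

theorem chebNode_eq (n k : ℕ) : chebNode n k = cos (nodeAngle n k) := rfl

theorem nodeAngle_strictMono {n : ℕ} (hn : 0 < n) : StrictMono (nodeAngle n) := by
  intro i j hij
  have h : (i : ℝ) < j := by exact_mod_cast hij
  have := pi_pos
  unfold nodeAngle
  gcongr

theorem nodeAngle_mem {n k : ℕ} (hk : k ∈ Icc 1 n) : nodeAngle n k ∈ Set.Ioo 0 π := by
  rw [Finset.mem_Icc] at hk
  have h1 : (1 : ℝ) ≤ k := by exact_mod_cast hk.1
  have h2 : (k : ℝ) ≤ n := by exact_mod_cast hk.2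
  have := pi_pos
  unfold nodeAngle
  constructor
  · apply div_pos <;> nlinarith
  · rw [div_lt_iff₀ (by linarith)]
    nlinarith

theorem chebNode_injOn (n : ℕ) : Set.InjOn (chebNode n) (Icc 1 n : Finset ℕ) := by
  intro i hi j hj h
  have hn : 0 < n := by
    have := Finset.mem_Icc.1 (Finset.mem_coe.1 hi); omega
  exact (nodeAngle_strictMono hn).injective
    (injOn_cos (Set.Ioo_subset_Icc_self (nodeAngle_mem hi))
      (Set.Ioo_subset_Icc_self (nodeAngle_mem hj)) h)

theorem mul_nodeAngle {n k : ℕ} (hn : 0 < n) : (n : ℝ) * nodeAngle n k = (k : ℝ) * π - π / 2 := by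
  have : (n : ℝ) ≠ 0 := by positivity
  unfold nodeAngle
  field_simp

theorem sin_mul_nodeAngle {n k : ℕ} (hn : 0 < n) :
    sin ((n : ℝ) * nodeAngle n k) = -(-1) ^ k := by
  rw [mul_nodeAngle hn, sin_sub_pi_div_two, cos_nat_mul_pi]

/-- The nodes are `n` distinct roots of a polynomial of degree `n`. The constant is its leading
coefficient, whose value never matters because it cancels in the interpolation formula. -/
theorem chebyshev_eq_C_mul_nodal {n : ℕ} (hn : 0 < n) :
    ∃ c : ℝ, c ≠ 0 ∧
      Polynomial.Chebyshev.T ℝ n = Polynomial.C c * Lagrange.nodal (Icc 1 n) (chebNode n) := by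
  have himg : (range n).image (fun k : ℕ => cos ((2 * k + 1) * π / (2 * n)))
      = (Icc 1 n).image (chebNode n) := by
    ext y
    simp only [mem_image, mem_range, Finset.mem_Icc]
    constructor
    · rintro ⟨k, hk, rfl⟩
      refine ⟨k + 1, by omega, ?_⟩
      simp only [chebNode]
      congr 1
      push_cast
      ring
    · rintro ⟨k, hk, rfl⟩
      obtain ⟨j, rfl⟩ := Nat.exists_eq_add_of_le' hk.1
      refine ⟨j, by omega, ?_⟩
      simp only [chebNode]
      congr 1
      push_cast
      ring
  have hroots := Polynomial.Chebyshev.roots_T_real n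
  rw [himg] at hroots
  have hcard : ((Icc 1 n).image (chebNode n)).card = n := by
    rw [card_image_of_injOn (chebNode_injOn n)]
    simp
  have hdeg : (Polynomial.Chebyshev.T ℝ n).natDegree = n := by
    simp
  have hne : Polynomial.Chebyshev.T ℝ n ≠ 0 := by
    intro h
    rw [h] at hdeg
    simp at hdeg
    omega
  refine ⟨(Polynomial.Chebyshev.T ℝ n).leadingCoeff, by simp, ?_⟩
  have := Polynomial.C_leadingCoeff_mul_prod_multiset_X_sub_C (p := Polynomial.Chebyshev.T ℝ n)
    (by rw [hroots, Finset.card_val, hcard, hdeg])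
  rw [← this, hroots, Lagrange.nodal_eq]
  simp only [Polynomial.leadingCoeff_mul, Polynomial.leadingCoeff_C]
  congr 1
  · congr 1
    rw [Polynomial.leadingCoeff_multiset_prod]
    simp
  · rw [← prod_image (s := Icc 1 n) (g := chebNode n) (f := fun a => Polynomial.X - Polynomial.C a)
      (chebNode_injOn n)]
    rfl

/-- The kernel `sin τ / (cos τ - x)`. -/
noncomputable def kern (x τ : ℝ) : ℝ := sin τ / (cos τ - x)

/-- The weights come from `T_n' = n U_{n-1}` together with `U_{n-1}(cos τ) sin τ = sin (n τ)`, which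
equals `-(-1)^k` at the nodes. -/
theorem lagrangeOp_eq_sum {n : ℕ} (hn : 0 < n) (f : ℝ → ℝ) {x : ℝ}
    (hx : ∀ k ∈ Icc 1 n, x ≠ chebNode n k) :
    lagrangeOp n f x = (Polynomial.Chebyshev.T ℝ n).eval x / n *
      ∑ k ∈ Icc 1 n, (-1) ^ k * kern x (nodeAngle n k) * f (chebNode n k) := by
  obtain ⟨c, hc, hT⟩ := chebyshev_eq_C_mul_nodal hn
  have hn' : (n : ℝ) ≠ 0 := by positivity
  unfold lagrangeOp
  rw [Lagrange.eval_interpolate_not_at_node _ hx, mul_sum, mul_sum]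
  refine sum_congr rfl fun k hk => ?_
  have hs : sin (nodeAngle n k) ≠ 0 := (sin_pos_of_mem_Ioo (nodeAngle_mem hk)).ne'
  have hd := congrArg (fun p => (Polynomial.derivative p).eval (chebNode n k)) hT
  simp only [Polynomial.Chebyshev.T_derivative_eq_U, Polynomial.derivative_mul,
    Polynomial.derivative_C, zero_mul, zero_add, Polynomial.eval_mul, Polynomial.eval_C] at hd
  have hU := Polynomial.Chebyshev.U_real_cos (nodeAngle n k) ((n : ℤ) - 1)
  rw [← chebNode_eq] at hU
  have hU2 : (Polynomial.Chebyshev.U ℝ ((n : ℤ) - 1)).eval (chebNode n k) * sin (nodeAngle n k)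
      = -(-1) ^ k := by
    rw [hU, ← sin_mul_nodeAngle hn]
    congr 1
    push_cast
    ring
  rw [Lagrange.nodalWeight_eq_eval_derivative_nodal hk]
  set D := Polynomial.eval (chebNode n k)
    (Polynomial.derivative (Lagrange.nodal (Icc 1 n) (chebNode n))) with hD
  have hsgn : ((-1 : ℝ) ^ k) * (-1) ^ k = 1 := by
    rw [← pow_add, ← two_mul, pow_mul]; simp
  have hd2 : c * D * sin (nodeAngle n k) = -(n : ℝ) * (-1) ^ k := by
    rw [← hd, mul_assoc, hU2]
    simp
  have hD0 : D ≠ 0 := by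
    intro h
    rw [h] at hd2
    simp at hd2
    omega
  have hxk : x - chebNode n k ≠ 0 := sub_ne_zero.2 (hx k hk)
  have hxk' : chebNode n k - x ≠ 0 := sub_ne_zero.2 (hx k hk).symm
  have hcD : D⁻¹ = -(-1) ^ k * c * sin (nodeAngle n k) / n := by
    rw [eq_div_iff hn', inv_mul_eq_iff_eq_mul₀ hD0]
    have : D * (-(-1) ^ k * c * sin (nodeAngle n k))
      = -(-1) ^ k * (c * D * sin (nodeAngle n k)) := by ring
    rw [this, hd2]
    linear_combination (-(n : ℝ)) * hsgn
  rw [hcD, hT, Polynomial.eval_mul, Polynomial.eval_C]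
  unfold kern
  rw [← chebNode_eq]
  have : (x - chebNode n k)⁻¹ = - (chebNode n k - x)⁻¹ := by
    rw [← neg_sub, inv_neg]
  rw [this, div_eq_mul_inv (sin _)]
  ring

theorem lagrangeOp_chebNode {n k : ℕ} (hk : k ∈ Icc 1 n) (f : ℝ → ℝ) :
    lagrangeOp n f (chebNode n k) = f (chebNode n k) :=
  Lagrange.eval_interpolate_at_node _ (chebNode_injOn n) hk

theorem lagrangeOp_sub_one {n : ℕ} (hn : 0 < n) (f : ℝ → ℝ) (x : ℝ) :
    lagrangeOp n (fun y => f y - 1) x = lagrangeOp n f x - 1 := by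
  have h1 : Lagrange.interpolate (Icc 1 n) (chebNode n) (fun _ => (1 : ℝ)) = 1 :=
    Lagrange.interpolate_one (chebNode_injOn n) (by simpa using (show 1 ≤ n from hn))
  unfold lagrangeOp
  have : (fun k => f (chebNode n k) - 1) = (fun k => f (chebNode n k)) - fun _ => (1 : ℝ) := rfl
  rw [this, map_sub, h1]
  simp

/-! ### Uniform convergence away from the jump -/

theorem hasDerivAt_kern {x τ : ℝ} (h : cos τ - x ≠ 0) :
    HasDerivAt (kern x) ((1 - x * cos τ) / (cos τ - x) ^ 2) τ := by
  have := (hasDerivAt_sin τ).div ((hasDerivAt_cos τ).sub_const x) h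
  refine this.congr_deriv ?_
  congr 1
  linear_combination sin_sq_add_cos_sq τ

/-- The numerator `1 - x cos τ` of the derivative is nonnegative because `|x| ≤ 1`. -/
theorem kern_monotoneOn {x : ℝ} (hx : x ∈ Set.Icc (-1 : ℝ) 1) {s : Set ℝ} (hs : Convex ℝ s)
    (h : ∀ τ ∈ s, cos τ - x ≠ 0) : MonotoneOn (kern x) s := by
  refine monotoneOn_of_deriv_nonneg hs
    (fun τ hτ => (hasDerivAt_kern (h τ hτ)).continuousAt.continuousWithinAt)
    (fun τ hτ => (hasDerivAt_kern (h τ (interior_subset hτ))).differentiableAt.differentiableWithinAt)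
    (fun τ hτ => ?_)
  rw [(hasDerivAt_kern (h τ (interior_subset hτ))).deriv]
  have h1 := cos_le_one τ
  have h2 := neg_one_le_cos τ
  have : x * cos τ ≤ 1 := by nlinarith [hx.1, hx.2]
  exact div_nonneg (by linarith) (sq_nonneg _)

theorem abs_kern_le {x τ δ : ℝ} (hδ : 0 < δ) (h : δ ≤ |cos τ - x|) : |kern x τ| ≤ 1 / δ := by
  unfold kern
  rw [abs_div]
  exact div_le_div₀ zero_le_one (abs_sin_le_one τ) hδ h

theorem nodeAngle_lt_iff {n k : ℕ} (hn : 0 < n) {θ : ℝ} :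
    nodeAngle n k < θ ↔ (k : ℝ) < n * (θ / π) + 1 / 2 := by
  have hn' : (0 : ℝ) < n := by exact_mod_cast hn
  have := pi_pos
  unfold nodeAngle
  rw [div_lt_iff₀ (by positivity), ← sub_lt_iff_lt_add, mul_div_assoc', lt_div_iff₀ this]
  constructor <;> intro h <;> linarith

theorem lt_nodeAngle_iff {n k : ℕ} (hn : 0 < n) {θ : ℝ} :
    θ < nodeAngle n k ↔ n * (θ / π) + 1 / 2 < (k : ℝ) := by
  have hn' : (0 : ℝ) < n := by exact_mod_cast hn
  have := pi_pos
  unfold nodeAngle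
  rw [lt_div_iff₀ (by positivity), ← lt_sub_iff_add_lt, mul_div_assoc', div_lt_iff₀ this]
  constructor <;> intro h <;> linarith

theorem filter_nodeAngle_lt {n : ℕ} (hn : 0 < n) {θ : ℝ} (hθ : θ ∈ Set.Ioo 0 π) :
    (Icc 1 n).filter (fun k => nodeAngle n k < θ) = Ico 1 ⌈n * (θ / π) + 1 / 2⌉₊ := by
  ext k
  simp only [mem_filter, Finset.mem_Icc, Finset.mem_Ico, nodeAngle_lt_iff hn, Nat.lt_ceil]
  refine ⟨fun h => ⟨h.1.1, h.2⟩, fun h => ⟨⟨h.1, ?_⟩, h.2⟩⟩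
  have h1 : θ / π < 1 := (div_lt_one pi_pos).2 hθ.2
  have hn' : (0 : ℝ) < n := by exact_mod_cast hn
  have : (k : ℝ) < n + 1 := by nlinarith [h.2]
  exact Nat.lt_succ_iff.1 (by exact_mod_cast this)

theorem filter_lt_nodeAngle {n : ℕ} (hn : 0 < n) {θ : ℝ} (hθ : θ ∈ Set.Ioo 0 π) :
    (Icc 1 n).filter (fun k => θ < nodeAngle n k)
      = Ico (⌊n * (θ / π) + 1 / 2⌋₊ + 1) (n + 1) := by
  have h0 : 0 ≤ n * (θ / π) + 1 / 2 := by have := hθ.1; have := pi_pos; positivity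
  ext k
  simp only [mem_filter, Finset.mem_Icc, Finset.mem_Ico, lt_nodeAngle_iff hn, Nat.succ_le_iff,
    ← Nat.floor_lt h0]
  omega

theorem stepFn_chebNode {n k : ℕ} (hk : k ∈ Icc 1 n) {θ : ℝ} (hθ : θ ∈ Set.Ioo 0 π) (d : ℝ) :
    stepFn (cos θ) d (chebNode n k) =
      (if nodeAngle n k < θ then 1 else 0) + if nodeAngle n k = θ then d else 0 := by
  have hm := Set.Ioo_subset_Icc_self (nodeAngle_mem hk)
  have hθ' := Set.Ioo_subset_Icc_self hθ
  have h1 : chebNode n k < cos θ ↔ θ < nodeAngle n k := strictAntiOn_cos.lt_iff_gt hm hθ'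
  have h2 : chebNode n k = cos θ ↔ nodeAngle n k = θ := injOn_cos.eq_iff hm hθ'
  unfold stepFn
  simp only [h1, h2]
  rcases lt_trichotomy (nodeAngle n k) θ with h | h | h
  · simp [h, h.ne, h.le]
  · simp [h]
  · simp [h, h.ne', h.le]

theorem stepFn_chebNode_sub_one {n k : ℕ} (hk : k ∈ Icc 1 n) {θ : ℝ} (hθ : θ ∈ Set.Ioo 0 π)
    (d : ℝ) :
    stepFn (cos θ) d (chebNode n k) - 1 =
      (if θ < nodeAngle n k then -1 else 0) + if nodeAngle n k = θ then d - 1 else 0 := by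
  rw [stepFn_chebNode hk hθ]
  rcases lt_trichotomy (nodeAngle n k) θ with h | h | h
  · simp [h, h.ne, h.not_gt]
  · simp [h]
  · simp [h, h.ne', h.not_gt]

/-- At most one node can coincide with the jump; this controls the influence of the value `d` there.
-/
theorem abs_sum_node_eq_le {n : ℕ} (hn : 0 < n) {θ e C : ℝ} (hC : 0 ≤ C) {c : ℕ → ℝ}
    (hc : ∀ k ∈ Icc 1 n, nodeAngle n k = θ → |c k| ≤ C) :
    |∑ k ∈ Icc 1 n, c k * (if nodeAngle n k = θ then e else 0)| ≤ C * |e| := by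
  simp only [mul_ite, mul_zero]
  rw [← sum_filter]
  have hcard : ((Icc 1 n).filter (fun k => nodeAngle n k = θ)).card ≤ 1 := by
    refine card_le_one.2 fun i hi j hj => (nodeAngle_strictMono hn).injective ?_
    rw [(mem_filter.1 hi).2, (mem_filter.1 hj).2]
  refine (abs_sum_le_sum_abs _ _).trans ?_
  refine (sum_le_card_nsmul _ _ (C * |e|) fun k hk => ?_).trans ?_
  · rw [abs_mul]
    exact mul_le_mul_of_nonneg_right (hc k (mem_filter.1 hk).1 (mem_filter.1 hk).2) (abs_nonneg _)
  · rw [nsmul_eq_mul]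
    have : (((Icc 1 n).filter (fun k => nodeAngle n k = θ)).card : ℝ) ≤ 1 := by exact_mod_cast hcard
    have h0 : 0 ≤ C * |e| := by positivity
    nlinarith

/-- Only nodes across the jump from `x`, or at the jump, contribute, and for those the kernel is at
most `1 / δ`. The alternating sum costs `2 / δ`, a node at the jump at most `(|d| + 1) / δ`. -/
theorem abs_lagrangeOp_stepFn_sub_le {θ d x δ : ℝ} {n : ℕ} (hθ : θ ∈ Set.Ioo 0 π) (hn : 0 < n)
    (hx : x ∈ Set.Icc (-1 : ℝ) 1) (hδ : 0 < δ) (hxδ : δ ≤ |x - cos θ|) :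
    |lagrangeOp n (stepFn (cos θ) d) x - stepFn (cos θ) d x| ≤ (3 + |d|) / δ / n := by
  have hn' : (0 : ℝ) < n := by exact_mod_cast hn
  by_cases hnode : ∃ k ∈ Icc 1 n, x = chebNode n k
  · obtain ⟨k, hk, rfl⟩ := hnode
    rw [lagrangeOp_chebNode hk]
    simp only [sub_self, abs_zero]
    positivity
  push Not at hnode
  have hT : |(Polynomial.Chebyshev.T ℝ n).eval x| ≤ 1 :=
    Polynomial.Chebyshev.abs_eval_T_real_le_one n (abs_le.2 hx)
  have key : ∀ S : ℝ, |S| ≤ (3 + |d|) / δ →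
      |(Polynomial.Chebyshev.T ℝ n).eval x / n * S| ≤ (3 + |d|) / δ / n := by
    intro S hS
    rw [abs_mul, abs_div, Nat.abs_cast, div_mul_eq_mul_div]
    gcongr
    calc _ ≤ 1 * |S| := by gcongr
      _ ≤ _ := by rwa [one_mul]
  have hmemIcc : ∀ k ∈ Icc 1 n, nodeAngle n k ∈ Set.Icc 0 π := fun k hk =>
    Set.Ioo_subset_Icc_self (nodeAngle_mem hk)
  rcases lt_or_ge x (cos θ) with hlt | hge
  · have hδ' : δ ≤ cos θ - x := by rwa [abs_sub_comm, abs_of_pos (by linarith)] at hxδ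
    have hcos : ∀ τ ∈ Set.Icc 0 θ, δ ≤ cos τ - x := fun τ hτ => by
      have := cos_le_cos_of_nonneg_of_le_pi hτ.1 hθ.2.le hτ.2
      linarith
    have hst : stepFn (cos θ) d x = 0 := by simp [stepFn, hlt]
    rw [hst, sub_zero, lagrangeOp_eq_sum hn _ hnode]
    apply key
    rw [sum_congr rfl (fun k hk => by rw [stepFn_chebNode hk hθ d, mul_add]), sum_add_distrib]
    have e1 : ∑ k ∈ Icc 1 n, (-1 : ℝ) ^ k * kern x (nodeAngle n k) *
          (if nodeAngle n k < θ then (1 : ℝ) else 0)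
        = ∑ k ∈ Ico 1 ⌈n * (θ / π) + 1 / 2⌉₊, (-1 : ℝ) ^ k * kern x (nodeAngle n k) := by
      simp only [mul_ite, mul_one, mul_zero]
      rw [← sum_filter, filter_nodeAngle_lt hn hθ]
    have hmono := kern_monotoneOn hx (convex_Icc 0 θ) (fun τ hτ => by have := hcos τ hτ; linarith)
    have hmem : ∀ k, 1 ≤ k → k < ⌈n * (θ / π) + 1 / 2⌉₊ → nodeAngle n k ∈ Set.Icc 0 θ := by
      intro k h1 h2
      have : k ∈ (Icc 1 n).filter (fun k => nodeAngle n k < θ) := by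
        rw [filter_nodeAngle_lt hn hθ]; exact Finset.mem_Ico.2 ⟨h1, h2⟩
      rw [mem_filter] at this
      exact ⟨(hmemIcc k this.1).1, this.2.le⟩
    have b1 := abs_alternating_sum_Ico_le_of_monotone (b := fun k => kern x (nodeAngle n k))
      (m := 1) (N := ⌈n * (θ / π) + 1 / 2⌉₊) (C := 1 / δ)
      (fun i j hi hij hj => hmono (hmem i hi (by omega)) (hmem j (by omega) hj)
        ((nodeAngle_strictMono hn).monotone hij))
      (fun i hi hj => abs_kern_le hδ ((hcos _ (hmem i hi hj)).trans (le_abs_self _)))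
      (by positivity)
    have b2 := abs_sum_node_eq_le hn (θ := θ) (e := d) (C := 1 / δ) (by positivity)
      (c := fun k => (-1 : ℝ) ^ k * kern x (nodeAngle n k)) (fun k hk he => by
        rw [abs_mul, abs_pow, abs_neg, abs_one, one_pow, one_mul, he]
        exact abs_kern_le hδ ((hcos _ ⟨hθ.1.le, le_rfl⟩).trans (le_abs_self _)))
    rw [e1]
    refine (abs_add_le _ _).trans ((add_le_add b1 b2).trans ?_)
    rw [div_eq_mul_one_div (3 + |d|)]
    have : 0 < 1 / δ := by positivity
    nlinarith
  · have hgt : cos θ < x := by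
      rcases hge.eq_or_lt with h | h
      · rw [h, sub_self, abs_zero] at hxδ; linarith
      · exact h
    have hδ' : δ ≤ x - cos θ := by rwa [abs_of_pos (by linarith)] at hxδ
    have hcos : ∀ τ ∈ Set.Icc θ π, δ ≤ |cos τ - x| := fun τ hτ => by
      have := cos_le_cos_of_nonneg_of_le_pi hθ.1.le hτ.2 hτ.1
      rw [abs_sub_comm]
      exact le_trans (by linarith) (le_abs_self _)
    have hst : stepFn (cos θ) d x = 1 := by simp [stepFn, hgt.not_gt, hgt.ne']
    -- Interpolation reproduces constants, so the step minus `1` may be interpolated instead; it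
    -- vanishes at the nodes on the same side of the jump as `x`.
    rw [hst, ← lagrangeOp_sub_one hn, lagrangeOp_eq_sum hn _ hnode]
    apply key
    rw [sum_congr rfl (fun k hk => by rw [stepFn_chebNode_sub_one hk hθ d, mul_add]),
      sum_add_distrib]
    have e1 : ∑ k ∈ Icc 1 n, (-1 : ℝ) ^ k * kern x (nodeAngle n k) *
          (if θ < nodeAngle n k then (-1 : ℝ) else 0)
        = -∑ k ∈ Ico (⌊n * (θ / π) + 1 / 2⌋₊ + 1) (n + 1),
            (-1 : ℝ) ^ k * kern x (nodeAngle n k) := by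
      simp only [mul_ite, mul_neg, mul_one, mul_zero]
      rw [← sum_filter, filter_lt_nodeAngle hn hθ, sum_neg_distrib]
    have hmono := kern_monotoneOn hx (convex_Icc θ π) (fun τ hτ h => by
      have := hcos τ hτ
      rw [h, abs_zero] at this
      linarith)
    have hmem : ∀ k, ⌊n * (θ / π) + 1 / 2⌋₊ + 1 ≤ k → k < n + 1 → nodeAngle n k ∈ Set.Icc θ π := by
      intro k h1 h2
      have : k ∈ (Icc 1 n).filter (fun k => θ < nodeAngle n k) := by
        rw [filter_lt_nodeAngle hn hθ]; exact Finset.mem_Ico.2 ⟨h1, h2⟩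
      rw [mem_filter] at this
      exact ⟨this.2.le, (hmemIcc k this.1).2⟩
    have b1 := abs_alternating_sum_Ico_le_of_monotone (b := fun k => kern x (nodeAngle n k))
      (m := ⌊n * (θ / π) + 1 / 2⌋₊ + 1) (N := n + 1) (C := 1 / δ)
      (fun i j hi hij hj => hmono (hmem i hi (by omega)) (hmem j (by omega) hj)
        ((nodeAngle_strictMono hn).monotone hij))
      (fun i hi hj => abs_kern_le hδ (hcos _ (hmem i hi hj)))
      (by positivity)
    have b2 := abs_sum_node_eq_le hn (θ := θ) (e := d - 1) (C := 1 / δ) (by positivity)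
      (c := fun k => (-1 : ℝ) ^ k * kern x (nodeAngle n k)) (fun k hk he => by
        rw [abs_mul, abs_pow, abs_neg, abs_one, one_pow, one_mul, he]
        exact abs_kern_le hδ (hcos _ ⟨le_rfl, hθ.2.le⟩))
    rw [e1]
    refine (abs_add_le _ _).trans ((add_le_add ((abs_neg _).trans_le b1) b2).trans ?_)
    rw [div_eq_mul_one_div (3 + |d|)]
    have h0 : 0 < 1 / δ := by positivity
    have h1 : |d - 1| ≤ |d| + 1 := by simpa using abs_sub d 1
    nlinarith

theorem tendstoUniformlyOn_lagrangeOp_stepFn {θ : ℝ} (d : ℝ) (hθ : θ ∈ Set.Ioo 0 π) {K : Set ℝ}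
    (hK : IsCompact K) (hKs : K ⊆ Set.Icc (-1) 1 \ {cos θ}) :
    TendstoUniformlyOn (fun n : ℕ => lagrangeOp n (stepFn (cos θ) d)) (stepFn (cos θ) d)
      Filter.atTop K := by
  obtain ⟨δ, hδ, hKδ⟩ : ∃ δ > 0, ∀ x ∈ K, δ ≤ |x - cos θ| := by
    have hopen : Kᶜ ∈ 𝓝 (cos θ) :=
      hK.isClosed.isOpen_compl.mem_nhds (fun h => (hKs h).2 rfl)
    obtain ⟨δ, hδ, hb⟩ := Metric.mem_nhds_iff.1 hopen
    refine ⟨δ, hδ, fun x hx => ?_⟩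
    by_contra! h
    exact hb (show x ∈ Metric.ball (cos θ) δ by rwa [Metric.mem_ball, Real.dist_eq]) hx
  rw [Metric.tendstoUniformlyOn_iff]
  intro ε hε
  have hlim := tendsto_const_div_atTop_nhds_zero_nat ((3 + |d|) / δ)
  filter_upwards [hlim.eventually_lt_const hε, Filter.eventually_gt_atTop 0] with n hn hn0 x hx
  rw [dist_comm, Real.dist_eq]
  exact (abs_lagrangeOp_stepFn_sub_le hθ hn0 (hKs hx).1 hδ (hKδ x hx)).trans_lt hn

/-! ### The function `g` -/

theorem tendsto_lerchJ_one {a : ℝ} (ha : 0 < a) :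
    Filter.Tendsto (fun N : ℕ => ∑ n ∈ range N, (-1 : ℝ) ^ n * (1 / ((n : ℝ) + a)))
      Filter.atTop (𝓝 (lerchJ 1 a)) := by
  refine (tendsto_lerchJ one_pos ha).congr fun N => sum_congr rfl fun n _ => ?_
  rw [rpow_one]
  ring

theorem antitone_one_div_add {a : ℝ} (ha : 0 < a) : Antitone fun n : ℕ => 1 / ((n : ℝ) + a) := by
  intro m n h
  have : (m : ℝ) ≤ n := by exact_mod_cast h
  have : 0 ≤ (m : ℝ) := Nat.cast_nonneg m
  exact one_div_le_one_div_of_le (by positivity) (by linarith)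

theorem le_lerchJ_one {a : ℝ} (ha : 0 < a) : 1 / a - 1 / (1 + a) ≤ lerchJ 1 a := by
  have := (antitone_one_div_add ha).alternating_series_le_tendsto (tendsto_lerchJ_one ha) 1
  simp only [mul_one, sum_range_succ, sum_range_zero] at this
  norm_num at this
  norm_num
  linarith

/-- The termwise difference is again an alternating series with decreasing terms, so it lies between
its two-term and its one-term partial sums. -/
theorem lerchJ_one_sub_mem {x y : ℝ} (hx : 0 < x) (hxy : x ≤ y) :
    lerchJ 1 x - lerchJ 1 y ∈
      Set.Icc ((y - x) / (x * y) - (y - x) / ((1 + x) * (1 + y))) ((y - x) / (x * y)) := by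
  have hy : 0 < y := hx.trans_le hxy
  have hlim : Filter.Tendsto
      (fun N : ℕ => ∑ n ∈ range N, (-1 : ℝ) ^ n * ((y - x) / (((n : ℝ) + x) * ((n : ℝ) + y))))
      Filter.atTop (𝓝 (lerchJ 1 x - lerchJ 1 y)) := by
    refine ((tendsto_lerchJ_one hx).sub (tendsto_lerchJ_one hy)).congr fun N => ?_
    rw [← sum_sub_distrib]
    refine sum_congr rfl fun n _ => ?_
    have h1 : (n : ℝ) + x ≠ 0 := by positivity
    have h2 : (n : ℝ) + y ≠ 0 := by positivity
    field_simp
    ring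
  have hanti : Antitone fun n : ℕ => (y - x) / (((n : ℝ) + x) * ((n : ℝ) + y)) := by
    intro m n h
    have : (m : ℝ) ≤ n := by exact_mod_cast h
    have h0 : 0 ≤ y - x := by linarith
    show (y - x) / (((n : ℝ) + x) * ((n : ℝ) + y)) ≤ (y - x) / (((m : ℝ) + x) * ((m : ℝ) + y))
    gcongr
  have h1 := hanti.alternating_series_le_tendsto hlim 1
  have h2 := hanti.tendsto_le_alternating_series hlim 0
  simp only [mul_one, mul_zero, zero_add, sum_range_succ, sum_range_zero, pow_zero, pow_one,
    one_mul, Nat.cast_zero, Nat.cast_one] at h1 h2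
  exact ⟨by linarith, h2⟩

theorem abs_lerchJ_one_sub_partial_le {a : ℝ} (ha : 0 < a) (N : ℕ) :
    |lerchJ 1 a - ∑ n ∈ range N, (-1 : ℝ) ^ n * (1 / ((n : ℝ) + a))| ≤ 1 / (N + a) := by
  have hlim := ((tendsto_lerchJ_one ha).comp (Filter.tendsto_add_atTop_nat N)).sub_const
    (∑ n ∈ range N, (-1 : ℝ) ^ n * (1 / ((n : ℝ) + a)))
  refine le_of_tendsto hlim.abs ?_
  filter_upwards [Filter.eventually_gt_atTop 0] with M hM
  have hanti := antitone_one_div_add ha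
  have hnn : ∀ n : ℕ, 0 ≤ 1 / ((n : ℝ) + a) := fun n => by positivity
  obtain ⟨h1, h2⟩ := alternating_sum_nonneg_le (b := fun i => 1 / (((N + i : ℕ) : ℝ) + a)) (N := M)
    (fun i j hij _ => hanti (by omega)) (fun i _ => hnn _)
  have h2 := h2 hM
  have e : ∑ n ∈ range (M + N), (-1 : ℝ) ^ n * (1 / ((n : ℝ) + a)) -
      ∑ n ∈ range N, (-1 : ℝ) ^ n * (1 / ((n : ℝ) + a))
      = (-1) ^ N * ∑ i ∈ range M, (-1 : ℝ) ^ i * (1 / (((N + i : ℕ) : ℝ) + a)) := by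
    rw [add_comm M N, sum_range_add, add_sub_cancel_left, mul_sum]
    refine sum_congr rfl fun i _ => ?_
    rw [pow_add, mul_assoc]
  simp only [Function.comp_apply]
  rw [e, abs_mul, abs_pow, abs_neg, abs_one, one_pow, one_mul, abs_of_nonneg h1]
  simpa using h2

/-! ### Reflection formula for the alternating series and for `g` -/

theorem tendsto_cot_partial_fractions {x : ℝ} (hx : x ∈ Set.Ioo (0 : ℝ) 1) :
    Filter.Tendsto
      (fun n : ℕ => ∑ j ∈ range n, (1 / (x - ((j : ℝ) + 1)) + 1 / (x + ((j : ℝ) + 1))))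
      Filter.atTop (𝓝 (π * (cos (π * x) / sin (π * x)) - 1 / x)) := by
  have hmem : (x : ℂ) ∈ Complex.integerComplement := by
    rintro ⟨m, hm⟩
    have hm' : (m : ℝ) = x := by exact_mod_cast hm
    have h1 : (0 : ℝ) < m := hm' ▸ hx.1
    have h2 : (m : ℝ) < 1 := hm' ▸ hx.2
    have h1' : 0 < m := by exact_mod_cast h1
    have h2' : m < 1 := by exact_mod_cast h2
    omega
  have := tendsto_logDeriv_euler_cot_sub hmem
  rw [← Filter.tendsto_ofReal_iff]
  refine (this.congr fun n => ?_).trans_eq ?_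
  · simp [cotTerm]
  · congr 1
    simp [Complex.cot]

/-- Regrouping the two series turns them into the cotangent expansions at `z / 2` and `(1 - z) / 2`,
and `cot (πz/2) + tan (πz/2) = 2 / sin (πz)`. -/
theorem lerchJ_one_add_reflect {z : ℝ} (hz : z ∈ Set.Ioo (0 : ℝ) 1) :
    lerchJ 1 z + lerchJ 1 (1 - z) = π / sin (π * z) := by
  obtain ⟨hz0, hz1⟩ := hz
  have h1 := tendsto_cot_partial_fractions (x := z / 2) ⟨by linarith, by linarith⟩
  have h2 := tendsto_cot_partial_fractions (x := (1 - z) / 2) ⟨by linarith, by linarith⟩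
  have h3 := (((h1.add h2).const_mul (1 / 2)).const_add (1 / z + 1 / (1 - z)))
  -- An odd number of terms is taken so that, after the terms of index `0`, the indices `2j + 1` and
  -- `2j + 2` pair up to form the `j`-th brackets of the cotangent expansions.
  have hsub : Filter.Tendsto (fun M : ℕ => 2 * M + 1) Filter.atTop Filter.atTop :=
    Filter.tendsto_atTop_mono (fun n => show n ≤ 2 * n + 1 by omega) Filter.tendsto_id
  have h4 := ((tendsto_lerchJ_one hz0).add (tendsto_lerchJ_one (a := 1 - z) (by linarith))).comp hsub
  have e : ∀ M : ℕ, ((∑ n ∈ range (2 * M + 1), (-1 : ℝ) ^ n * (1 / ((n : ℝ) + z))) +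
      ∑ n ∈ range (2 * M + 1), (-1 : ℝ) ^ n * (1 / ((n : ℝ) + (1 - z))))
      = (1 / z + 1 / (1 - z)) + 1 / 2 * ((∑ j ∈ range M, (1 / (z / 2 - ((j : ℝ) + 1)) +
        1 / (z / 2 + ((j : ℝ) + 1)))) + ∑ j ∈ range M, (1 / ((1 - z) / 2 - ((j : ℝ) + 1)) +
        1 / ((1 - z) / 2 + ((j : ℝ) + 1)))) := by
    intro M
    induction M with
    | zero => simp
    | succ M ih =>
      have hM : (0 : ℝ) ≤ M := Nat.cast_nonneg M
      rw [show 2 * (M + 1) + 1 = (2 * M + 1) + 1 + 1 by ring]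
      simp only [sum_range_succ _ (2 * M + 1 + 1), sum_range_succ _ (2 * M + 1),
        sum_range_succ _ M]
      have p1 : (-1 : ℝ) ^ (2 * M + 1) = -1 := by rw [pow_succ, pow_mul]; simp
      have p2 : (-1 : ℝ) ^ (2 * M + 1 + 1) = 1 := by rw [pow_succ, p1]; simp
      rw [p1, p2]
      push_cast
      have a1 : 1 / (z / 2 - ((M : ℝ) + 1)) = -2 * (1 / (2 * (M : ℝ) + 1 + (1 - z))) := by
        rw [div_eq_iff (by linarith)]
        field_simp [show 2 * (M : ℝ) + 1 + (1 - z) ≠ 0 by linarith]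
        ring
      have a2 : 1 / (z / 2 + ((M : ℝ) + 1)) = 2 * (1 / (2 * (M : ℝ) + 1 + 1 + z)) := by
        rw [div_eq_iff (by linarith)]
        field_simp [show 2 * (M : ℝ) + 1 + 1 + z ≠ 0 by linarith]
        ring
      have a3 : 1 / ((1 - z) / 2 - ((M : ℝ) + 1)) = -2 * (1 / (2 * (M : ℝ) + 1 + z)) := by
        rw [div_eq_iff (by linarith)]
        field_simp [show 2 * (M : ℝ) + 1 + z ≠ 0 by linarith]
        ring
      have a4 : 1 / ((1 - z) / 2 + ((M : ℝ) + 1)) = 2 * (1 / (2 * (M : ℝ) + 1 + 1 + (1 - z))) := by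
        rw [div_eq_iff (by linarith)]
        field_simp [show 2 * (M : ℝ) + 1 + 1 + (1 - z) ≠ 0 by linarith]
        ring
      rw [a1, a2, a3, a4]
      linear_combination ih
  have h5 := tendsto_nhds_unique (h4.congr fun M => e M) h3
  rw [h5]
  have c1 : cos (π * ((1 - z) / 2)) = sin (π * (z / 2)) := by
    rw [← cos_pi_div_two_sub]; congr 1; ring
  have c2 : sin (π * ((1 - z) / 2)) = cos (π * (z / 2)) := by
    rw [← sin_pi_div_two_sub]; congr 1; ring
  have c3 : sin (π * z) = 2 * sin (π * (z / 2)) * cos (π * (z / 2)) := by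
    rw [← sin_two_mul]; congr 1; ring
  have hp := pi_pos
  have s1 : sin (π * (z / 2)) ≠ 0 := (sin_pos_of_pos_of_lt_pi (by positivity) (by nlinarith)).ne'
  have s2 : cos (π * (z / 2)) ≠ 0 :=
    (cos_pos_of_mem_Ioo ⟨by nlinarith, by nlinarith⟩).ne'
  rw [c1, c2, c3]
  have hz1' : 1 - z ≠ 0 := by linarith
  have hz0' := hz0.ne'
  have key : cos (π * (z / 2)) / sin (π * (z / 2)) + sin (π * (z / 2)) / cos (π * (z / 2))
      = 1 / (sin (π * (z / 2)) * cos (π * (z / 2))) := by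
    rw [div_add_div _ _ s1 s2, ← sin_sq_add_cos_sq (π * (z / 2))]
    ring
  have key2 : π / (2 * sin (π * (z / 2)) * cos (π * (z / 2)))
      = π / 2 * (1 / (sin (π * (z / 2)) * cos (π * (z / 2)))) := by
    field_simp
  rw [key2, ← key]
  have d1 : 1 / (z / 2) = 2 * (1 / z) := by field_simp
  have d2 : 1 / ((1 - z) / 2) = 2 * (1 / (1 - z)) := by field_simp
  rw [d1, d2]
  ring

theorem g_one_sub {z : ℝ} (hz : z ∈ Set.Ioo (0 : ℝ) 1) : g (1 - z) = 1 - g z := by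
  have h := lerchJ_one_add_reflect hz
  have hs : sin (π * (1 - z)) = sin (π * z) := by
    rw [← sin_pi_sub]; congr 1; ring
  have hp := pi_pos
  have hpos : 0 < sin (π * z) :=
    sin_pos_of_pos_of_lt_pi (mul_pos hp hz.1) (by nlinarith [hz.2])
  unfold g
  rw [hs, eq_sub_iff_add_eq'.2 h]
  field_simp

/-- To the right of `1 / 2` both factors of `g` are positive and decreasing, so their rates of
decrease add up; the other half of the interval follows by reflection. -/
theorem le_g_sub_of_half_le {x y : ℝ} (hx : 1 / 2 ≤ x) (hxy : x ≤ y) (hy : y < 1) :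
    (y - x) / (2 * π) ≤ g x - g y := by
  have hp := pi_pos
  have hx0 : 0 < x := by linarith
  have hy0 : 0 < y := by linarith
  have hJ : 1 / 2 ≤ lerchJ 1 x := by
    refine le_trans ?_ (le_lerchJ_one hx0)
    rw [div_sub_div _ _ hx0.ne' (by linarith), div_le_div_iff₀ (by norm_num) (by positivity)]
    nlinarith
  have hJd : (y - x) / 2 ≤ lerchJ 1 x - lerchJ 1 y := by
    refine le_trans ?_ (lerchJ_one_sub_mem hx0 hxy).1
    have hd : (y - x) / (x * y) - (y - x) / ((1 + x) * (1 + y))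
        = (y - x) * ((1 + x + y) / (x * y * ((1 + x) * (1 + y)))) := by
      field_simp
      ring
    rw [hd, div_eq_mul_one_div]
    refine mul_le_mul_of_nonneg_left ?_ (by linarith)
    rw [div_le_div_iff₀ (by norm_num) (by positivity)]
    have h1 : x * y ≤ 1 := by nlinarith
    have h2 : (1 + x) * (1 + y) ≤ 4 := by nlinarith
    have h3 : x * y * ((1 + x) * (1 + y)) ≤ 1 * 4 :=
      mul_le_mul h1 h2 (by positivity) (by norm_num)
    linarith
  have hsin : 2 * (x + y - 1) * (y - x) ≤ sin (π * x) - sin (π * y) := by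
    have e1 : sin (π * x) - sin (π * y)
        = 2 * (sin (π * (y - x) / 2) * sin (π * (x + y - 1) / 2)) := by
      rw [sin_sub_sin, show π * (x + y - 1) / 2 = (π * x + π * y) / 2 - π / 2 by ring,
        sin_sub_pi_div_two, show (π * x - π * y) / 2 = -(π * (y - x) / 2) by ring, sin_neg]
      ring
    have b1 : y - x ≤ sin (π * (y - x) / 2) := by
      have := mul_le_sin (x := π * (y - x) / 2) (by nlinarith) (by nlinarith)
      have e : 2 / π * (π * (y - x) / 2) = y - x := by field_simp
      linarith
    have b2 : x + y - 1 ≤ sin (π * (x + y - 1) / 2) := by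
      have := mul_le_sin (x := π * (x + y - 1) / 2) (by nlinarith) (by nlinarith)
      have e : 2 / π * (π * (x + y - 1) / 2) = x + y - 1 := by field_simp
      linarith
    rw [e1]
    have := mul_le_mul b1 b2 (by linarith) (by linarith)
    linarith
  have hsy : 2 * (1 - y) ≤ sin (π * y) := by
    have := mul_le_sin (x := π * (1 - y)) (by nlinarith) (by nlinarith)
    rw [show π * (1 - y) = π - π * y by ring, sin_pi_sub] at this
    have e : 2 / π * (π - π * y) = 2 * (1 - y) := by field_simp
    linarith
  -- With the bounds above, the numerator is at least `(y - x) ((x + y - 1) + (1 - y)) = (y - x) x`,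
  -- and `x ≥ 1 / 2`.
  have e : g x - g y = ((sin (π * x) - sin (π * y)) * lerchJ 1 x +
      sin (π * y) * (lerchJ 1 x - lerchJ 1 y)) / π := by
    unfold g
    ring
  rw [e, div_mul_eq_div_div]
  refine div_le_div_of_nonneg_right ?_ hp.le
  have h1 := mul_le_mul hsin hJ (by norm_num) (le_trans (by
    have : 0 ≤ x + y - 1 := by linarith
    have : 0 ≤ y - x := by linarith
    positivity) hsin)
  have h2 := mul_le_mul hsy hJd (by linarith) (le_trans (by linarith) hsy)
  nlinarith

theorem le_g_sub {x y : ℝ} (hx : 0 < x) (hxy : x ≤ y) (hy : y < 1) :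
    (y - x) / (2 * π) ≤ g x - g y := by
  have refl : ∀ a b : ℝ, 0 < a → a ≤ b → b ≤ 1 / 2 → (b - a) / (2 * π) ≤ g a - g b := by
    intro a b ha hab hb
    have := le_g_sub_of_half_le (x := 1 - b) (y := 1 - a) (by linarith) (by linarith) (by linarith)
    rw [g_one_sub ⟨ha, by linarith⟩, g_one_sub ⟨by linarith, by linarith⟩] at this
    convert this using 1 <;> ring
  rcases le_total (1 / 2) x with h | h
  · exact le_g_sub_of_half_le h hxy hy
  rcases le_total y (1 / 2) with h' | h'
  · exact refl x y hx hxy h'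
  · have h1 := refl x (1 / 2) hx h le_rfl
    have h2 := le_g_sub_of_half_le le_rfl h' hy
    have e : (y - x) / (2 * π) = (1 / 2 - x) / (2 * π) + (y - 1 / 2) / (2 * π) := by ring
    linarith

theorem abs_sub_le_abs_g_sub {x y : ℝ} (hx : x ∈ Set.Ioo (0 : ℝ) 1) (hy : y ∈ Set.Ioo (0 : ℝ) 1) :
    |x - y| ≤ 2 * π * |g x - g y| := by
  have hp : 0 < 2 * π := by positivity
  rcases le_total x y with h | h
  · have := le_g_sub hx.1 h hy.2
    rw [div_le_iff₀' hp] at this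
    rw [abs_sub_comm, abs_of_nonneg (by linarith)]
    exact this.trans (mul_le_mul_of_nonneg_left (le_abs_self _) hp.le)
  · have := le_g_sub hy.1 h hx.2
    rw [div_le_iff₀' hp] at this
    rw [abs_sub_comm (g x), abs_of_nonneg (by linarith)]
    exact this.trans (mul_le_mul_of_nonneg_left (le_abs_self _) hp.le)

theorem g_injOn : Set.InjOn g (Set.Ioo 0 1) := by
  intro x hx y hy h
  have := abs_sub_le_abs_g_sub hx hy
  rw [h, sub_self, abs_zero, mul_zero] at this
  exact sub_eq_zero.1 (abs_nonpos_iff.1 this)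

theorem continuousAt_lerchJ_one {x : ℝ} (hx : 0 < x) : ContinuousAt (lerchJ 1) x := by
  have hb : ∀ᶠ y in 𝓝 x, |lerchJ 1 y - lerchJ 1 x| ≤ |y - x| / (x * y) := by
    filter_upwards [lt_mem_nhds hx] with y hy
    rcases le_total x y with h | h
    · have h1 := lerchJ_one_sub_mem hx h
      have h2 : 0 ≤ (y - x) / (x * y) - (y - x) / ((1 + x) * (1 + y)) := by
        have h3 : 0 ≤ y - x := by linarith
        have : (y - x) / ((1 + x) * (1 + y)) ≤ (y - x) / (x * y) := by
          gcongr <;> linarith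
        linarith
      rw [abs_sub_comm, abs_of_nonneg (h2.trans h1.1), abs_of_nonneg (by linarith)]
      exact h1.2
    · have h1 := lerchJ_one_sub_mem hy h
      have h2 : 0 ≤ (x - y) / (y * x) - (x - y) / ((1 + y) * (1 + x)) := by
        have h3 : 0 ≤ x - y := by linarith
        have : (x - y) / ((1 + y) * (1 + x)) ≤ (x - y) / (y * x) := by
          gcongr <;> linarith
        linarith
      rw [abs_of_nonneg (h2.trans h1.1), abs_sub_comm, abs_of_nonneg (by linarith), mul_comm x y]
      exact h1.2
  have hlim : Filter.Tendsto (fun y => |y - x| / (x * y)) (𝓝 x) (𝓝 0) := by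
    have : ContinuousAt (fun y => |y - x| / (x * y)) x := by
      refine ContinuousAt.div (by fun_prop) (by fun_prop) (by positivity)
    simpa [ContinuousAt] using this
  rw [ContinuousAt, tendsto_iff_dist_tendsto_zero]
  exact squeeze_zero' (Filter.Eventually.of_forall fun _ => dist_nonneg)
    (hb.mono fun y hy => by rwa [Real.dist_eq]) hlim

theorem continuousOn_g : ContinuousOn g (Set.Ioo 0 1) := fun x hx =>
  (((by fun_prop : ContinuousAt (fun x => sin (π * x) / π) x)).mul
    (continuousAt_lerchJ_one hx.1)).continuousWithinAt

/-! ### The interpolants at the jump -/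

theorem hasDerivAt_cos_div_sin {v : ℝ} (h : sin v ≠ 0) :
    HasDerivAt (fun v => cos v / sin v) (-1 / sin v ^ 2) v := by
  refine ((hasDerivAt_cos v).div (hasDerivAt_sin v) h).congr_deriv ?_
  congr 1
  linear_combination -sin_sq_add_cos_sq v

theorem antitoneOn_cos_div_sin : AntitoneOn (fun v => cos v / sin v) (Set.Ioo 0 π) := by
  have hs : ∀ v ∈ Set.Ioo 0 π, sin v ≠ 0 := fun v hv => (sin_pos_of_mem_Ioo hv).ne'
  refine antitoneOn_of_deriv_nonpos (convex_Ioo _ _)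
    (fun v hv => (hasDerivAt_cos_div_sin (hs v hv)).continuousAt.continuousWithinAt)
    (fun v hv => (hasDerivAt_cos_div_sin
      (hs v (interior_subset hv))).differentiableAt.differentiableWithinAt) (fun v hv => ?_)
  rw [(hasDerivAt_cos_div_sin (hs v (interior_subset hv))).deriv, neg_div]
  exact neg_nonpos.2 (by positivity)

theorem antitoneOn_cos_div_sin_sub_inv :
    AntitoneOn (fun v => cos v / sin v - 1 / v) (Set.Ioo 0 π) := by
  have hd : ∀ v ∈ Set.Ioo 0 π,
      HasDerivAt (fun v => cos v / sin v - 1 / v) (-1 / sin v ^ 2 + 1 / v ^ 2) v := fun v hv => by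
    have h := (hasDerivAt_cos_div_sin (sin_pos_of_mem_Ioo hv).ne').sub (hasDerivAt_inv hv.1.ne')
    simp only [one_div]
    refine h.congr_deriv ?_
    ring
  refine antitoneOn_of_deriv_nonpos (convex_Ioo _ _)
    (fun v hv => (hd v hv).continuousAt.continuousWithinAt)
    (fun v hv => (hd v (interior_subset hv)).differentiableAt.differentiableWithinAt)
    (fun v hv => ?_)
  have hv' := interior_subset hv
  rw [(hd v hv').deriv, neg_div]
  have h1 : 0 < sin v := sin_pos_of_mem_Ioo hv'
  have h2 : sin v ≤ v := sin_le hv'.1.le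
  have : 1 / v ^ 2 ≤ 1 / sin v ^ 2 := by gcongr
  linarith

/-- The difference is at most `0` because `v < tan v`, and being decreasing it is at least its value
`-2 / π` at `π / 2`. -/
theorem abs_cos_div_sin_sub_inv_le {v : ℝ} (hv : v ∈ Set.Ioo 0 (π / 2)) :
    |cos v / sin v - 1 / v| ≤ 1 := by
  have hp := pi_pos
  have hmem : v ∈ Set.Ioo 0 π := ⟨hv.1, by linarith [hv.2]⟩
  have h1 : 0 < sin v := sin_pos_of_mem_Ioo hmem
  have h2 : 0 < cos v := cos_pos_of_mem_Ioo ⟨by linarith [hv.1], hv.2⟩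
  rw [abs_le]
  constructor
  · have := antitoneOn_cos_div_sin_sub_inv hmem ⟨by linarith, by linarith⟩ hv.2.le
    simp only [cos_pi_div_two, sin_pi_div_two, zero_div] at this
    have h3 : 1 / (π / 2) ≤ 1 := by
      rw [div_le_one (by linarith)]; linarith [pi_gt_three]
    linarith
  · have := lt_tan hv.1 hv.2
    rw [tan_eq_sin_div_cos, lt_div_iff₀ h2] at this
    have : cos v / sin v ≤ 1 / v := by
      rw [div_le_div_iff₀ h1 hv.1]
      linarith
    linarith

/-- This separates the pole: `cot (u / 2) / 2` behaves like `1 / u`, while the other cotangent stays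
bounded for `0 < u < θ`. -/
theorem kern_cos_sub {θ u : ℝ} (hu : 0 < u) (huθ : u < θ) (hθ : θ < π) :
    kern (cos θ) (θ - u) =
      1 / 2 * (cos (u / 2) / sin (u / 2) - cos (θ - u / 2) / sin (θ - u / 2)) := by
  have h1 : sin (u / 2) ≠ 0 := (sin_pos_of_pos_of_lt_pi (by linarith) (by linarith)).ne'
  have h2 : sin (θ - u / 2) ≠ 0 := (sin_pos_of_pos_of_lt_pi (by linarith) (by linarith)).ne'
  have e1 : cos (θ - u) - cos θ = 2 * sin (θ - u / 2) * sin (u / 2) := by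
    rw [cos_sub_cos, show (θ - u + θ) / 2 = θ - u / 2 by ring,
      show (θ - u - θ) / 2 = -(u / 2) by ring, sin_neg]
    ring
  have e2 : sin (θ - u) = sin (θ - u / 2) * cos (u / 2) - cos (θ - u / 2) * sin (u / 2) := by
    rw [← sin_sub]; congr 1; ring
  rw [kern, e1, e2, div_sub_div _ _ h1 h2, div_mul_div_comm]
  congr 1 <;> ring

/-- A bound for `kern (cos θ) (θ - u) - 1 / u` on `0 < u < θ`. -/
noncomputable def kernBound (θ : ℝ) : ℝ :=
  1 / 2 * (1 + (|cos θ / sin θ| + |cos (θ / 2) / sin (θ / 2)|))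

theorem kernBound_nonneg (θ : ℝ) : 0 ≤ kernBound θ := by
  unfold kernBound; positivity

theorem kern_cos_sub_sub_inv {θ u : ℝ} (hu : 0 < u) (huθ : u < θ) (hθ : θ < π) :
    kern (cos θ) (θ - u) - 1 / u = 1 / 2 * ((cos (u / 2) / sin (u / 2) - 1 / (u / 2)) -
      cos (θ - u / 2) / sin (θ - u / 2)) := by
  rw [kern_cos_sub hu huθ hθ]
  field_simp
  ring

theorem antitoneOn_kern_sub_inv {θ : ℝ} (hθ : θ < π) :
    AntitoneOn (fun u => kern (cos θ) (θ - u) - 1 / u) (Set.Ioo 0 θ) := by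
  intro u hu w hw huw
  simp only
  rw [kern_cos_sub_sub_inv hu.1 hu.2 hθ, kern_cos_sub_sub_inv hw.1 hw.2 hθ]
  have h1 := antitoneOn_cos_div_sin_sub_inv (a := u / 2) (b := w / 2)
    ⟨by linarith [hu.1], by linarith [hu.2, hu.1]⟩ ⟨by linarith [hw.1], by linarith [hw.2, hw.1]⟩
    (by linarith)
  have h2 := antitoneOn_cos_div_sin (a := θ - w / 2) (b := θ - u / 2)
    ⟨by linarith [hw.1, hw.2], by linarith [hw.1]⟩ ⟨by linarith [hu.1, hu.2], by linarith [hu.1]⟩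
    (by linarith)
  simp only at h1 h2
  linarith

theorem abs_kern_sub_inv_le {θ u : ℝ} (hθ : θ < π) (hu : u ∈ Set.Ioo 0 θ) :
    |kern (cos θ) (θ - u) - 1 / u| ≤ kernBound θ := by
  obtain ⟨hu0, hu1⟩ := hu
  rw [kern_cos_sub_sub_inv hu0 hu1 hθ, kernBound, abs_mul, abs_of_pos (by norm_num : (0 : ℝ) < 1 / 2)]
  refine mul_le_mul_of_nonneg_left ?_ (by norm_num)
  refine (abs_sub _ _).trans (add_le_add
    (abs_cos_div_sin_sub_inv_le ⟨by linarith, by linarith⟩) ?_)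
  have h1 := antitoneOn_cos_div_sin (a := θ - u / 2) (b := θ)
    ⟨by linarith, by linarith⟩ ⟨by linarith, by linarith⟩ (by linarith)
  have h2 := antitoneOn_cos_div_sin (a := θ / 2) (b := θ - u / 2)
    ⟨by linarith, by linarith⟩ ⟨by linarith, by linarith⟩ (by linarith)
  simp only at h1 h2
  rw [abs_le]
  constructor
  · linarith [neg_abs_le (cos θ / sin θ), abs_nonneg (cos (θ / 2) / sin (θ / 2))]
  · linarith [le_abs_self (cos (θ / 2) / sin (θ / 2)), abs_nonneg (cos θ / sin θ)]

/-- The position of the jump relative to the neighbouring nodes. -/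
noncomputable def phase (θ : ℝ) (n : ℕ) : ℝ := Int.fract (n * (θ / π) + 1 / 2)

theorem nodeAngle_eq_iff {n k : ℕ} (hn : 0 < n) {θ : ℝ} :
    nodeAngle n k = θ ↔ n * (θ / π) + 1 / 2 = (k : ℝ) := by
  rw [le_antisymm_iff, ← not_lt, ← not_lt, nodeAngle_lt_iff hn, lt_nodeAngle_iff hn, not_lt, not_lt,
    le_antisymm_iff, and_comm]

theorem lagrangeOp_stepFn_of_phase_eq_zero {θ d : ℝ} (hθ : θ ∈ Set.Ioo 0 π) {n : ℕ} (hn : 0 < n)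
    (ht : phase θ n = 0) : lagrangeOp n (stepFn (cos θ) d) (cos θ) = d := by
  have hp := pi_pos
  have hn' : (0 : ℝ) < n := by exact_mod_cast hn
  have h0 : 0 < θ / π := div_pos hθ.1 hp
  have h1 : θ / π < 1 := (div_lt_one hp).2 hθ.2
  obtain ⟨m, hm⟩ := Int.fract_eq_zero_iff.1 ht
  have hm0 : (0 : ℝ) < m := by rw [hm]; positivity
  have hm1 : (m : ℝ) < n + 1 := by rw [hm]; nlinarith
  have hm0' : 0 < m := by exact_mod_cast hm0
  have hm1' : m < n + 1 := by exact_mod_cast hm1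
  lift m to ℕ using hm0'.le
  have hk : m ∈ Icc 1 n := Finset.mem_Icc.2 ⟨by omega, by omega⟩
  have : cos θ = chebNode n m := by
    rw [chebNode_eq, (nodeAngle_eq_iff hn (k := m) (θ := θ)).2 (by simpa using hm.symm)]
  rw [this, lagrangeOp_chebNode hk]
  simp [stepFn]

/-- Numbering the nodes from the jump outwards exposes the series of `g`. The kernel minus `1 / u`
gives the term with `kernBound`, and truncating the series after `N` terms gives the term `1 / θ`.
-/
theorem abs_lagrangeOp_stepFn_sub_g_le {θ d : ℝ} (hθ : θ ∈ Set.Ioo 0 π) {n : ℕ} (hn : 0 < n)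
    (ht : phase θ n ≠ 0) :
    |lagrangeOp n (stepFn (cos θ) d) (cos θ) - g (phase θ n)| ≤
      (2 * kernBound θ + 1 / θ) / n := by
  have hp := pi_pos
  have hn' : (0 : ℝ) < n := by exact_mod_cast hn
  have h0 : 0 < θ / π := div_pos hθ.1 hp
  set a : ℝ := n * (θ / π) + 1 / 2 with ha
  have ha0 : 0 ≤ a := by positivity
  set N : ℕ := ⌊a⌋₊ with hN
  set t := phase θ n with htdef
  have hNt : a = N + t := by
    rw [htdef, phase, ← ha, hN, natCast_floor_eq_intCast_floor ha0]
    exact (Int.floor_add_fract a).symm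
  have ht0 : 0 < t := lt_of_le_of_ne (Int.fract_nonneg _) ht.symm
  have ht1 : t < 1 := Int.fract_lt_one _
  have hnot : ∀ k : ℕ, nodeAngle n k ≠ θ := by
    intro k hk
    rw [nodeAngle_eq_iff hn, ← ha] at hk
    apply ht
    rw [htdef, phase, ← ha, hk, Int.fract_natCast]
  have hnode : ∀ k ∈ Icc 1 n, cos θ ≠ chebNode n k := by
    intro k hk h
    exact hnot k (injOn_cos (Set.Ioo_subset_Icc_self (nodeAngle_mem hk))
      (Set.Ioo_subset_Icc_self hθ) h.symm)
  have hceil : ⌈a⌉₊ = N + 1 := by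
    rw [Nat.ceil_eq_iff (by omega)]
    constructor
    · rw [Nat.add_sub_cancel]
      linarith
    · push_cast
      linarith
  have hu : ∀ m : ℕ, m < N → π * (m + t) / n ∈ Set.Ioo 0 θ := by
    intro m hm
    have hm' : (m : ℝ) + 1 ≤ N := by exact_mod_cast hm
    constructor
    · positivity
    · rw [div_lt_iff₀ hn']
      have : π * (a - 1 / 2) = θ * n := by rw [ha]; field_simp; ring
      nlinarith
  have hang : ∀ m : ℕ, m < N → nodeAngle n (N - m) = θ - π * (m + t) / n := by
    intro m hm
    have : (((N - m : ℕ) : ℝ)) = N - m := by rw [Nat.cast_sub hm.le]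
    unfold nodeAngle
    rw [this]
    have : θ = π * (N + t - 1 / 2) / n := by
      rw [← hNt, ha]; field_simp; ring
    rw [this]
    field_simp
    ring
  have hTn : (Polynomial.Chebyshev.T ℝ n).eval (cos θ) = (-1) ^ N * sin (π * t) := by
    have h := Polynomial.Chebyshev.T_real_cos θ n
    rw [h]
    have : ((n : ℤ) : ℝ) * θ = π * t + N * π - π / 2 := by
      have : (n : ℝ) * θ = π * (a - 1 / 2) := by rw [ha]; field_simp; ring
      push_cast
      rw [this, hNt]; ring
    rw [this, cos_sub_pi_div_two, sin_add_nat_mul_pi]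
  have hL : lagrangeOp n (stepFn (cos θ) d) (cos θ)
      = sin (π * t) / n * ∑ m ∈ range N, (-1 : ℝ) ^ m * kern (cos θ) (θ - π * (m + t) / n) := by
    rw [lagrangeOp_eq_sum hn _ hnode,
      sum_congr rfl (fun k hk => by rw [stepFn_chebNode hk hθ d, if_neg (hnot k), add_zero])]
    simp only [mul_ite, mul_one, mul_zero]
    rw [← sum_filter, filter_nodeAngle_lt hn hθ, ← ha, hceil, sum_Ico_eq_sum_range,
      Nat.add_sub_cancel, ← sum_range_reflect, hTn, mul_sum, mul_sum]
    refine sum_congr rfl fun m hm => ?_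
    have hm' := mem_range.1 hm
    rw [show 1 + (N - 1 - m) = N - m by omega, hang m hm']
    -- The sign of `T_n(cos θ)` cancels the sign of the node nearest to the jump, so the reversed
    -- sum starts with `+`.
    have hs : (-1 : ℝ) ^ N * (-1) ^ (N - m) = (-1) ^ m := by
      have : N = (N - m) + m := by omega
      nth_rewrite 1 [this]
      rw [pow_add, mul_right_comm, ← pow_add, ← two_mul, pow_mul]
      simp
    rw [← hs]
    ring
  have hsplit : lagrangeOp n (stepFn (cos θ) d) (cos θ) - g t
      = sin (π * t) / n * (∑ m ∈ range N, (-1 : ℝ) ^ m *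
          (kern (cos θ) (θ - π * (m + t) / n) - 1 / (π * (m + t) / n)))
        - sin (π * t) / π *
          (lerchJ 1 t - ∑ m ∈ range N, (-1 : ℝ) ^ m * (1 / ((m : ℝ) + t))) := by
    have e : sin (π * t) / n * (∑ m ∈ range N, (-1 : ℝ) ^ m * (1 / (π * (m + t) / n)))
        = sin (π * t) / π * ∑ m ∈ range N, (-1 : ℝ) ^ m * (1 / ((m : ℝ) + t)) := by
      rw [mul_sum, mul_sum]
      refine sum_congr rfl fun m _ => ?_
      have : (m : ℝ) + t ≠ 0 := by positivity
      field_simp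
    simp only [mul_sub, sum_sub_distrib]
    rw [hL, e]
    unfold g
    ring
  have b1 := abs_alternating_sum_le_of_antitone
    (b := fun m : ℕ => kern (cos θ) (θ - π * (m + t) / n) - 1 / (π * (m + t) / n))
    (N := N) (C := kernBound θ)
    (fun i j hij hj => antitoneOn_kern_sub_inv hθ.2 (hu i (by omega)) (hu j hj) (by
      have : (i : ℝ) ≤ j := by exact_mod_cast hij
      gcongr))
    (fun i hi => abs_kern_sub_inv_le hθ.2 (hu i hi)) (kernBound_nonneg θ)
  have b2 := abs_lerchJ_one_sub_partial_le ht0 N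
  have hs := abs_sin_le_one (π * t)
  rw [hsplit]
  refine (abs_sub _ _).trans ?_
  rw [abs_mul, abs_mul, abs_div, abs_div, Nat.abs_cast, abs_of_pos hp, add_div]
  refine add_le_add ?_ ?_
  · rw [div_mul_eq_mul_div]
    refine div_le_div_of_nonneg_right ?_ hn'.le
    exact (mul_le_mul hs b1 (abs_nonneg _) zero_le_one).trans_eq (one_mul _)
  · rw [← hNt] at b2
    have ha1 : n * (θ / π) ≤ a := by rw [ha]; linarith
    have hpos : 0 < n * (θ / π) := by positivity
    calc |sin (π * t)| / π * |lerchJ 1 t - ∑ m ∈ range N, (-1 : ℝ) ^ m * (1 / ((m : ℝ) + t))|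
        ≤ 1 / π * (1 / (n * (θ / π))) := by
          gcongr
          exact b2.trans (one_div_le_one_div_of_le hpos ha1)
      _ = 1 / θ / n := by
          have := hθ.1.ne'
          field_simp

/-- The values that the interpolants at the jump approach. -/
noncomputable def limitValue (θ d : ℝ) (n : ℕ) : ℝ :=
  if phase θ n = 0 then d else g (phase θ n)

theorem tendsto_lagrangeOp_stepFn_sub {θ : ℝ} (d : ℝ) (hθ : θ ∈ Set.Ioo 0 π) :
    Filter.Tendsto (fun n : ℕ => lagrangeOp n (stepFn (cos θ) d) (cos θ) - limitValue θ d n)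
      Filter.atTop (𝓝 0) := by
  refine squeeze_zero_norm' ?_ (tendsto_const_div_atTop_nhds_zero_nat (2 * kernBound θ + 1 / θ))
  filter_upwards [Filter.eventually_gt_atTop 0] with n hn
  have h0 := kernBound_nonneg θ
  have h1 := hθ.1
  rw [Real.norm_eq_abs, limitValue]
  split_ifs with ht
  · rw [lagrangeOp_stepFn_of_phase_eq_zero hθ hn ht, sub_self, abs_zero]
    positivity
  · exact abs_lagrangeOp_stepFn_sub_g_le hθ hn ht

/-! ### Densities -/

/-- The proportion of the elements of `K` among `1, …, n`. -/
noncomputable def proportion (K : Set ℕ) (n : ℕ) : ℝ := ((K ∩ Set.Icc 1 n).ncard : ℝ) / n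

theorem upperDensity_eq (K : Set ℕ) :
    upperDensity K = Filter.limsup (proportion K) Filter.atTop := rfl

theorem proportion_nonneg (K : Set ℕ) (n : ℕ) : 0 ≤ proportion K n := by
  unfold proportion; positivity

theorem proportion_add_compl (K : Set ℕ) {n : ℕ} (hn : 0 < n) :
    proportion K n + proportion Kᶜ n = 1 := by
  have hn' : (n : ℝ) ≠ 0 := by positivity
  have h := Set.ncard_inter_add_ncard_sdiff_eq_ncard (Set.Icc 1 n) K (Set.finite_Icc 1 n)
  rw [Set.inter_comm, Set.sdiff_eq, Set.inter_comm _ Kᶜ] at h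
  have hc : (Set.Icc 1 n).ncard = n := by
    rw [← Finset.coe_Icc, Set.ncard_coe_finset, Nat.card_Icc]; omega
  rw [hc] at h
  unfold proportion
  rw [← add_div, div_eq_one_iff_eq hn']
  exact_mod_cast h

theorem proportion_le_one (K : Set ℕ) (n : ℕ) : proportion K n ≤ 1 := by
  rcases Nat.eq_zero_or_pos n with rfl | hn
  · simp [proportion]
  · linarith [proportion_add_compl K hn, proportion_nonneg Kᶜ n]

theorem isBoundedUnder_le_proportion (K : Set ℕ) :
    Filter.IsBoundedUnder (· ≤ ·) Filter.atTop (proportion K) :=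
  Filter.isBoundedUnder_of ⟨1, proportion_le_one K⟩

theorem isBoundedUnder_ge_proportion (K : Set ℕ) :
    Filter.IsBoundedUnder (· ≥ ·) Filter.atTop (proportion K) :=
  Filter.isBoundedUnder_of ⟨0, proportion_nonneg K⟩

theorem upperDensity_le {K : Set ℕ} {c : ℝ}
    (h : ∀ η > 0, ∀ᶠ n in Filter.atTop, proportion K n ≤ c + η) : upperDensity K ≤ c :=
  le_of_forall_pos_le_add fun η hη => Filter.limsup_le_of_le
    (isBoundedUnder_ge_proportion K).isCoboundedUnder_le (h η hη)

theorem le_upperDensity {K : Set ℕ} {c : ℝ}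
    (h : ∀ η > 0, ∀ᶠ n in Filter.atTop, c - η ≤ proportion K n) : c ≤ upperDensity K := by
  refine le_of_forall_pos_le_add fun η hη => ?_
  have := Filter.le_limsup_of_frequently_le (h η hη).frequently (isBoundedUnder_le_proportion K)
  rw [upperDensity_eq]
  linarith

theorem upperDensity_le_one (K : Set ℕ) : upperDensity K ≤ 1 :=
  upperDensity_le fun η hη => Filter.Eventually.of_forall fun n => by
    linarith [proportion_le_one K n]

theorem proportion_le_add {K K' : Set ℕ} (h : ∀ᶠ n in Filter.atTop, n ∈ K → n ∈ K') :
    ∀ η > 0, ∀ᶠ n in Filter.atTop, proportion K n ≤ proportion K' n + η := by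
  intro η hη
  obtain ⟨N, hN⟩ := Filter.eventually_atTop.1 h
  filter_upwards [(tendsto_const_div_atTop_nhds_zero_nat (N : ℝ)).eventually_lt_const hη] with n hn
  have hsub : K ∩ Set.Icc 1 n ⊆ (K' ∩ Set.Icc 1 n) ∪ (Finset.range N : Set ℕ) := by
    intro k hk
    rcases lt_or_ge k N with h | h
    · exact Or.inr (by simpa using h)
    · exact Or.inl ⟨hN k h hk.1, hk.2⟩
  have hfin : ((K' ∩ Set.Icc 1 n) ∪ (Finset.range N : Set ℕ)).Finite :=
    ((Set.finite_Icc 1 n).inter_of_right K').union (Finset.finite_toSet _)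
  have h1 := (Set.ncard_le_ncard hsub hfin).trans (Set.ncard_union_le _ _)
  rw [Set.ncard_coe_finset, card_range] at h1
  have h2 : ((K ∩ Set.Icc 1 n).ncard : ℝ) ≤ (K' ∩ Set.Icc 1 n).ncard + N := by exact_mod_cast h1
  have h3 : proportion K n ≤ proportion K' n + N / n := by
    unfold proportion
    rw [← add_div]
    gcongr
  linarith

/-- Together with `le_upperDensity_of_eventually` this reduces both bounds on an index to lower
bounds on proportions. -/
theorem upperDensity_le_of_eventually {K G : Set ℕ} {c : ℝ}
    (h : ∀ᶠ n in Filter.atTop, n ∈ K → n ∉ G)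
    (hG : ∀ η > 0, ∀ᶠ n in Filter.atTop, c - η ≤ proportion G n) : upperDensity K ≤ 1 - c := by
  refine upperDensity_le fun η hη => ?_
  filter_upwards [proportion_le_add (K' := Gᶜ) h (η / 2) (by linarith), hG (η / 2) (by linarith),
    Filter.eventually_gt_atTop 0] with n h1 h2 h3
  linarith [proportion_add_compl G h3]

theorem le_upperDensity_of_eventually {K G : Set ℕ} {c : ℝ}
    (h : ∀ᶠ n in Filter.atTop, n ∈ G → n ∈ K)
    (hG : ∀ η > 0, ∀ᶠ n in Filter.atTop, c - η ≤ proportion G n) : c ≤ upperDensity K := by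
  refine le_upperDensity fun η hη => ?_
  filter_upwards [proportion_le_add h (η / 2) (by linarith), hG (η / 2) (by linarith)] with n h1 h2
  linarith

/-- The count up to `n` is a difference of two floors and misses `n / q` by at most `1`. -/
theorem tendsto_proportion_mod_eq {q r : ℕ} (hr : r < q) :
    Filter.Tendsto (proportion {n | n % q = r}) Filter.atTop (𝓝 (1 / q)) := by
  have hq : 0 < q := by omega
  have hcount : ∀ n : ℕ, |(({n | n % q = r} ∩ Set.Icc 1 n).ncard : ℝ) - n / q| ≤ 1 := by
    intro n
    have e : ({n | n % q = r} ∩ Set.Icc 1 n) = ↑((Ioc 0 n).filter (fun x => x ≡ r [MOD q])) := by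
      ext k
      simp only [Set.mem_inter_iff, Set.mem_ofPred_eq, Set.mem_Icc, Finset.coe_filter,
        Finset.mem_Ioc, Nat.ModEq, Nat.mod_eq_of_lt hr]
      constructor
      · rintro ⟨h1, h2, h3⟩; exact ⟨⟨by omega, h3⟩, h1⟩
      · rintro ⟨⟨h1, h2⟩, h3⟩; exact ⟨h3, by omega, h2⟩
    rw [e, Set.ncard_coe_finset]
    have h := Nat.Ioc_filter_modEq_card 0 n hq r
    have hmono : (⌊(((0 : ℕ) : ℚ) - r) / q⌋) ≤ ⌊((n : ℚ) - r) / q⌋ := by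
      apply Int.floor_le_floor
      gcongr
      exact n.zero_le
    rw [max_eq_left (sub_nonneg.2 hmono)] at h
    have f1 := Int.floor_le (((n : ℚ) - r) / q)
    have f2 := Int.lt_floor_add_one (((n : ℚ) - r) / q)
    have f3 := Int.floor_le ((((0 : ℕ) : ℚ) - r) / q)
    have f4 := Int.lt_floor_add_one ((((0 : ℕ) : ℚ) - r) / q)
    have e2 : ((n : ℚ) - r) / q - (((0 : ℕ) : ℚ) - r) / q = n / q := by push_cast; ring
    have hQ : |((#{x ∈ Ioc 0 n | x ≡ r [MOD q]} : ℕ) : ℚ) - n / q| ≤ 1 := by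
      have h' : ((#{x ∈ Ioc 0 n | x ≡ r [MOD q]} : ℕ) : ℚ)
          = (⌊((n : ℚ) - r) / q⌋ : ℚ) - (⌊(((0 : ℕ) : ℚ) - r) / q⌋ : ℚ) := by
        exact_mod_cast h
      rw [h', abs_le]
      constructor <;> linarith
    have hR := (Rat.cast_le (K := ℝ)).2 hQ
    push_cast at hR
    exact hR
  rw [tendsto_iff_dist_tendsto_zero]
  refine squeeze_zero' (Filter.Eventually.of_forall fun _ => dist_nonneg) ?_
    (tendsto_const_div_atTop_nhds_zero_nat (1 : ℝ))
  filter_upwards [Filter.eventually_gt_atTop 0] with n hn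
  have hn' : (0 : ℝ) < n := by exact_mod_cast hn
  have e : proportion {n | n % q = r} n - 1 / q
      = ((({n | n % q = r} ∩ Set.Icc 1 n).ncard : ℝ) - n / q) / n := by
    unfold proportion
    field_simp
  rw [Real.dist_eq, e, abs_div, Nat.abs_cast]
  exact div_le_div_of_nonneg_right (hcount n) hn'.le

theorem bddAbove_upperDensity {ι : Type*} (S : ι → Set ℕ) :
    BddAbove (Set.range fun i => upperDensity (S i)) :=
  ⟨1, by rintro _ ⟨i, rfl⟩; exact upperDensity_le_one _⟩

theorem mem_Iic_union_Ici {x L ε : ℝ} :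
    x ∈ Set.Iic (L - ε) ∪ Set.Ici (L + ε) ↔ ε ≤ |x - L| := by
  rw [le_abs]
  simp only [Set.mem_union, Set.mem_Iic, Set.mem_Ici]
  constructor
  · rintro (h | h)
    · right; linarith
    · left; linarith
  · rintro (h | h)
    · right; linarith
    · left; linarith

/-- A periodic sequence has finitely many values, so those different from `L` keep a positive
distance from it; for small `ε` the bad indices are then, up to finitely many, those outside the
class of `r`. -/
theorem convIndex_eq_of_periodic {x v : ℕ → ℝ} {q r : ℕ} {L : ℝ} (hr : r < q)
    (hx : Filter.Tendsto (fun n => x n - v n) Filter.atTop (𝓝 0))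
    (hper : ∀ n, v n = v (n % q)) (hL : ∀ n, v n = L ↔ n % q = r) :
    convIndex x L = 1 / q := by
  have hp := tendsto_proportion_mod_eq hr
  have hev : ∀ ε > 0, ∀ᶠ n in Filter.atTop, |x n - v n| < ε := fun ε hε => by
    have := (tendsto_order.1 hx.abs).2 ε (by simpa using hε)
    exact this
  have hup : ∀ ε : Set.Ioi (0 : ℝ),
      upperDensity {n | x n ∈ Set.Iic (L - (ε : ℝ)) ∪ Set.Ici (L + (ε : ℝ))} ≤ 1 - 1 / q := by
    intro ε
    refine upperDensity_le_of_eventually (G := {n | n % q = r}) ?_ fun η hη => ?_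
    · filter_upwards [hev ε ε.2] with n hn h1 h2
      replace h1 := mem_Iic_union_Ici.1 h1
      rw [(hL n).2 h2] at hn
      linarith
    · exact hp.eventually_const_le (by linarith)
  -- The factor `2` leaves a gap of `ε` after `x n` has been replaced by `v n` with an error below
  -- `ε`.
  obtain ⟨ε, hε0, hε⟩ : ∃ ε > 0, ∀ j ∈ (range q).erase r, 2 * ε < |v j - L| := by
    have hev : ∀ᶠ ε : ℝ in 𝓝[>] 0, ∀ j ∈ (range q).erase r, 2 * ε < |v j - L| := by
      rw [Filter.eventually_all_finset]
      intro j hj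
      rw [mem_erase, mem_range] at hj
      have hne : 0 < |v j - L| := by
        rw [abs_pos, sub_ne_zero, Ne, hL, Nat.mod_eq_of_lt hj.2]
        exact hj.1
      have hcont : Filter.Tendsto (fun ε : ℝ => 2 * ε) (𝓝[>] 0) (𝓝 0) := by
        have : Filter.Tendsto (fun ε : ℝ => 2 * ε) (𝓝 0) (𝓝 (2 * 0)) := by
          exact (continuous_const.mul continuous_id).tendsto 0
        rw [mul_zero] at this
        exact this.mono_left nhdsWithin_le_nhds
      exact hcont.eventually_lt_const hne
    obtain ⟨ε, h1, h2⟩ := (hev.and self_mem_nhdsWithin).exists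
    exact ⟨ε, h2, h1⟩
  have hlow : 1 - 1 / (q : ℝ) ≤
      upperDensity {n | x n ∈ Set.Iic (L - ε) ∪ Set.Ici (L + ε)} := by
    refine le_upperDensity_of_eventually (G := {n | n % q = r}ᶜ) ?_ fun η hη => ?_
    · filter_upwards [hev ε hε0] with n hn h1
      refine mem_Iic_union_Ici.2 ?_
      have h2 := hε (n % q) (mem_erase.2 ⟨h1, mem_range.2 (Nat.mod_lt _ (by omega))⟩)
      rw [← hper] at h2
      have := abs_sub_le (v n) (x n) L
      rw [abs_sub_comm (v n) (x n)] at this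
      linarith
    · filter_upwards [hp.eventually_le_const (show 1 / (q : ℝ) < 1 / q + η by linarith),
        Filter.eventually_gt_atTop 0] with n h1 h2
      linarith [proportion_add_compl {n | n % q = r} h2]
  have hsup : (⨆ ε : Set.Ioi (0 : ℝ),
      upperDensity {n | x n ∈ Set.Iic (L - (ε : ℝ)) ∪ Set.Ici (L + (ε : ℝ))}) = 1 - 1 / q := by
    have : Nonempty (Set.Ioi (0 : ℝ)) := ⟨⟨ε, hε0⟩⟩
    refine le_antisymm (ciSup_le hup) ?_
    exact le_ciSup_of_le (bddAbove_upperDensity _) ⟨ε, hε0⟩ hlow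
  rw [convIndex, hsup]
  ring

/-! ### Rational angles -/

/-- Since `p` is a unit mod `q`, the congruence has the single solution `-e p⁻¹`. -/
theorem exists_residue {p q : ℕ} (hq : q ≠ 0) (hpq : Nat.gcd p q = 1) (e : ℤ) :
    ∃ r < q, ∀ n : ℕ, (q : ℤ) ∣ n * p + e ↔ n % q = r := by
  have : NeZero q := ⟨hq⟩
  let u := ZMod.unitOfCoprime p hpq
  refine ⟨(-(e : ZMod q) * ↑u⁻¹).val, ZMod.val_lt _, fun n => ?_⟩
  rw [← ZMod.intCast_zmod_eq_zero_iff_dvd, ← ZMod.val_natCast, (ZMod.val_injective q).eq_iff,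
    Units.eq_mul_inv_iff_mul_eq, ZMod.coe_unitOfCoprime]
  push_cast
  rw [eq_neg_iff_add_eq_zero]

theorem phase_eq_iff {θ s : ℝ} {p q : ℕ} {e : ℤ} (hq : q ≠ 0) (hθ : θ / π = (p : ℝ) / q)
    (hs : s ∈ Set.Ico (0 : ℝ) 1) (he : 1 / 2 - s = (e : ℝ) / q) (n : ℕ) :
    phase θ n = s ↔ (q : ℤ) ∣ n * p + e := by
  have hq' : (q : ℝ) ≠ 0 := by exact_mod_cast hq
  rw [phase, Int.fract_eq_iff, hθ]
  have key : (n : ℝ) * (p / q) + 1 / 2 - s = ((n * p + e : ℤ) : ℝ) / q := by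
    rw [add_sub_assoc, he]; push_cast; ring
  rw [key]
  constructor
  · rintro ⟨_, _, z, hz⟩
    rw [div_eq_iff hq'] at hz
    exact ⟨z, by rw [mul_comm (q : ℤ)]; exact_mod_cast hz⟩
  · rintro ⟨z, hz⟩
    refine ⟨hs.1, hs.2, z, ?_⟩
    rw [hz]
    push_cast
    field_simp

theorem phase_mod {θ : ℝ} {p q : ℕ} (hq : q ≠ 0) (hθ : θ / π = (p : ℝ) / q) (n : ℕ) :
    phase θ n = phase θ (n % q) := by
  have hq' : (q : ℝ) ≠ 0 := by exact_mod_cast hq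
  have h : (n : ℝ) = q * (n / q : ℕ) + (n % q : ℕ) := by
    exact_mod_cast (Nat.div_add_mod n q).symm
  unfold phase
  rw [hθ]
  have : (n : ℝ) * (p / q) + 1 / 2
      = ((n % q : ℕ) : ℝ) * (p / q) + 1 / 2 + ((p * (n / q) : ℕ) : ℝ) := by
    nth_rewrite 1 [h]
    push_cast
    field_simp
    ring
  rw [this, Int.fract_add_natCast]

theorem phase_mem_Ioo {θ : ℝ} {n : ℕ} (h : phase θ n ≠ 0) : phase θ n ∈ Set.Ioo (0 : ℝ) 1 :=
  ⟨lt_of_le_of_ne (Int.fract_nonneg _) h.symm, Int.fract_lt_one _⟩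

/-- The condition on `d` is imposed only when the phase vanishes: for odd `q` this never happens,
and for even `q` it is the hypothesis of the theorem. -/
theorem limitValue_eq_g_iff {θ d s : ℝ} {n : ℕ} (hs : s ∈ Set.Ioo (0 : ℝ) 1)
    (hd : phase θ n = 0 → g s ≠ d) : limitValue θ d n = g s ↔ phase θ n = s := by
  unfold limitValue
  split_ifs with h
  · rw [h]
    exact iff_of_false (hd h).symm hs.1.ne
  · exact g_injOn.eq_iff (phase_mem_Ioo h) hs

theorem convIndex_lagrangeOp_of_phase {θ d L s : ℝ} {p q : ℕ} {e : ℤ} (hθ : θ ∈ Set.Ioo 0 π)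
    (hq : q ≠ 0) (hpq : Nat.gcd p q = 1) (h : θ / π = (p : ℝ) / q) (hs : s ∈ Set.Ico (0 : ℝ) 1)
    (he : 1 / 2 - s = (e : ℝ) / q) (hL : ∀ n, limitValue θ d n = L ↔ phase θ n = s) :
    convIndex (fun n => lagrangeOp n (stepFn (cos θ) d) (cos θ)) L = 1 / q := by
  obtain ⟨r, hr, hr'⟩ := exists_residue hq hpq e
  refine convIndex_eq_of_periodic hr (tendsto_lagrangeOp_stepFn_sub d hθ) (fun n => ?_) fun n => ?_
  · unfold limitValue
    rw [phase_mod hq h n]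
  · rw [hL, phase_eq_iff hq h hs he, hr']

theorem convIndex_lagrangeOp_of_odd {θ d : ℝ} {p q : ℕ} (hθ : θ ∈ Set.Ioo 0 π)
    (hpq : Nat.gcd p q = 1) (h : θ / π = (p : ℝ) / q) (hodd : Odd q) {m : ℕ}
    (hm : m < q) :
    convIndex (fun n => lagrangeOp n (stepFn (cos θ) d) (cos θ)) (g ((2 * (m : ℝ) + 1) / (2 * q)))
      = 1 / q := by
  have hq : q ≠ 0 := by omega
  obtain ⟨k, hk⟩ := hodd
  have hq' : (0 : ℝ) < q := by exact_mod_cast Nat.pos_of_ne_zero hq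
  have hm' : (m : ℝ) + 1 ≤ q := by exact_mod_cast hm
  have hs : (2 * (m : ℝ) + 1) / (2 * q) ∈ Set.Ioo (0 : ℝ) 1 := by
    constructor
    · positivity
    · rw [div_lt_one (by positivity)]; linarith
  refine convIndex_lagrangeOp_of_phase hθ hq hpq h ⟨hs.1.le, hs.2⟩ (e := (k : ℤ) - m) ?_
    fun n => limitValue_eq_g_iff hs fun h0 => ?_
  · have : (q : ℝ) = 2 * k + 1 := by exact_mod_cast hk
    push_cast
    field_simp
    rw [this]
    ring
  -- A vanishing phase would give `2qz = 2np + q`, making `q` even.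
  · exfalso
    obtain ⟨z, hz⟩ := Int.fract_eq_zero_iff.1 h0
    rw [h] at hz
    field_simp at hz
    have hz' : (q : ℤ) * 2 * z = 2 * (n * p) + q := by
      have : (q : ℝ) * 2 * z = 2 * (n * p) + q := by linarith
      exact_mod_cast this
    have hz2 : (q : ℤ) = 2 * ((q : ℤ) * z - n * p) := by linarith
    omega

theorem convIndex_lagrangeOp_node_of_even {θ d : ℝ} {p q : ℕ} (hθ : θ ∈ Set.Ioo 0 π) (hq : q ≠ 0)
    (hpq : Nat.gcd p q = 1) (h : θ / π = (p : ℝ) / q) (heven : Even q)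
    (hd : ∀ m : ℕ, 1 ≤ m → m < q → g ((m : ℝ) / q) ≠ d) :
    convIndex (fun n => lagrangeOp n (stepFn (cos θ) d) (cos θ)) d = 1 / q := by
  obtain ⟨k, hk⟩ := heven
  have hq' : (0 : ℝ) < q := by exact_mod_cast Nat.pos_of_ne_zero hq
  have hqk : (q : ℝ) = k + k := by exact_mod_cast hk
  refine convIndex_lagrangeOp_of_phase hθ hq hpq h ⟨le_rfl, one_pos⟩ (e := (k : ℤ)) ?_ fun n => ?_
  · push_cast
    field_simp
    rw [hqk]
    ring
  · unfold limitValue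
    split_ifs with h0
    · simp [h0]
    · refine iff_of_false (fun hg => ?_) h0
      obtain ⟨ht0, ht1⟩ := phase_mem_Ioo h0
      -- The numerator of the phase over `q`: a nonzero phase is some `m / q` with `0 < m < q`,
      -- where `g` avoids `d`.
      set z : ℤ := n * p + k - q * ⌊n * (θ / π) + 1 / 2⌋ with hz
      have hzt : phase θ n = (z : ℝ) / q := by
        rw [eq_div_iff hq'.ne', phase, Int.fract, hz, h]
        push_cast
        field_simp
        rw [hqk]
        ring
      rw [hzt] at ht0 ht1
      rw [div_lt_one hq'] at ht1
      have hz0 : 0 < z := by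
        have := (div_pos_iff_of_pos_right hq').1 ht0
        exact_mod_cast this
      have hz1 : z < q := by exact_mod_cast ht1
      clear_value z
      lift z to ℕ using hz0.le
      refine hd z (by omega) (by omega) ?_
      rw [← hg, hzt]
      simp

theorem convIndex_lagrangeOp_of_even {θ d : ℝ} {p q : ℕ} (hθ : θ ∈ Set.Ioo 0 π)
    (hpq : Nat.gcd p q = 1) (h : θ / π = (p : ℝ) / q) (heven : Even q) {m : ℕ} (hm1 : 1 ≤ m)
    (hm : m < q) (hd : g ((m : ℝ) / q) ≠ d) :
    convIndex (fun n => lagrangeOp n (stepFn (cos θ) d) (cos θ)) (g ((m : ℝ) / q)) = 1 / q := by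
  have hq : q ≠ 0 := by omega
  obtain ⟨k, hk⟩ := heven
  have hq' : (0 : ℝ) < q := by exact_mod_cast Nat.pos_of_ne_zero hq
  have hqk : (q : ℝ) = k + k := by exact_mod_cast hk
  have hm0 : (0 : ℝ) < m := by exact_mod_cast hm1
  have hs : (m : ℝ) / q ∈ Set.Ioo (0 : ℝ) 1 :=
    ⟨by positivity, (div_lt_one hq').2 (by exact_mod_cast hm)⟩
  refine convIndex_lagrangeOp_of_phase hθ hq hpq h ⟨hs.1.le, hs.2⟩ (e := (k : ℤ) - m) ?_
    fun n => limitValue_eq_g_iff hs fun _ => hd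
  push_cast
  field_simp
  rw [hqk]
  ring

/-! ### Jordan content and Lebesgue measure -/

/-- The compact grid interval `[k / N, (k + 1) / N]`. -/
noncomputable def gridInterval (N : ℕ) (k : ℤ) : ℝ × ℝ := ((k : ℝ) / N, ((k : ℝ) + 1) / N)

theorem gridInterval_injective {N : ℕ} (hN : 0 < N) : Function.Injective (gridInterval N) := by
  intro k l h
  have hN' : (N : ℝ) ≠ 0 := by positivity
  have := congrArg Prod.fst h
  simp only [gridInterval] at this
  rw [div_left_inj' hN'] at this
  exact_mod_cast this

theorem disjoint_grid_Ico {N : ℕ} (hN : 0 < N) {k l : ℤ} (h : k ≠ l) :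
    Disjoint (Set.Ico ((k : ℝ) / N) (((k : ℝ) + 1) / N))
      (Set.Ico ((l : ℝ) / N) (((l : ℝ) + 1) / N)) := by
  have hN' : (0 : ℝ) < N := by exact_mod_cast hN
  rw [Set.disjoint_left]
  rintro x ⟨h1, h2⟩ ⟨h3, h4⟩
  rw [div_le_iff₀ hN'] at h1 h3
  rw [lt_div_iff₀ hN'] at h2 h4
  have a1 : (k : ℝ) < l + 1 := by linarith
  have a2 : (l : ℝ) < k + 1 := by linarith
  have a1' : k < l + 1 := by exact_mod_cast a1
  have a2' : l < k + 1 := by exact_mod_cast a2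
  omega

theorem sum_grid_lengths (F : Finset ℤ) (N : ℕ) (c : ℝ) :
    ∑ k ∈ F, (((k : ℝ) + c) / N - k / N) = c * ((#F : ℝ) / N) := by
  rw [sum_congr rfl (fun (k : ℤ) _ => show ((k : ℝ) + c) / N - k / N = c / N by ring), sum_const,
    nsmul_eq_mul]
  ring

/-- The cells are those that meet `K`. Being half-open they are disjoint, so their total length is
the measure of their union. -/
theorem exists_grid_cover {K : Set ℝ} (hK : IsCompact K) {N : ℕ} (hN : 0 < N) :
    ∃ F : Finset ℤ, (K ⊆ ⋃ k ∈ F, Set.Ico ((k : ℝ) / N) (((k : ℝ) + 1) / N)) ∧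
      (∀ k ∈ F, Set.Icc ((k : ℝ) / N) (((k : ℝ) + 1) / N) ⊆ Metric.cthickening (1 / N) K) ∧
      volume.real K ≤ (#F : ℝ) / N ∧ (#F : ℝ) / N ≤ volume.real (Metric.cthickening (1 / N) K) := by
  have hN' : (0 : ℝ) < N := by exact_mod_cast hN
  have hfin : ((fun x : ℝ => ⌊N * x⌋) '' K).Finite := by
    obtain ⟨a, ha⟩ := hK.bddBelow
    obtain ⟨b, hb⟩ := hK.bddAbove
    refine (Set.finite_Icc ⌊N * a⌋ ⌊N * b⌋).subset ?_
    rintro _ ⟨x, hx, rfl⟩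
    exact ⟨Int.floor_le_floor (mul_le_mul_of_nonneg_left (ha hx) hN'.le),
      Int.floor_le_floor (mul_le_mul_of_nonneg_left (hb hx) hN'.le)⟩
  have hfloor : ∀ x : ℝ, x ∈ Set.Ico ((⌊N * x⌋ : ℝ) / N) (((⌊N * x⌋ : ℝ) + 1) / N) := by
    intro x
    constructor
    · rw [div_le_iff₀ hN', mul_comm]; exact Int.floor_le _
    · rw [lt_div_iff₀ hN', mul_comm]; exact Int.lt_floor_add_one _
  have hcover : K ⊆ ⋃ k ∈ hfin.toFinset, Set.Ico ((k : ℝ) / N) (((k : ℝ) + 1) / N) := by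
    intro x hx
    simp only [Set.mem_iUnion]
    exact ⟨_, hfin.mem_toFinset.2 ⟨x, hx, rfl⟩, hfloor x⟩
  have hsub : ∀ k ∈ hfin.toFinset,
      Set.Icc ((k : ℝ) / N) (((k : ℝ) + 1) / N) ⊆ Metric.cthickening (1 / N) K := by
    intro k hk y hy
    obtain ⟨x, hx, rfl⟩ := hfin.mem_toFinset.1 hk
    refine Metric.mem_cthickening_of_dist_le y x _ _ hx ?_
    have := hfloor x
    have e : ((⌊N * x⌋ : ℝ) + 1) / N = (⌊N * x⌋ : ℝ) / N + 1 / N := by ring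
    rw [Real.dist_eq, abs_le]
    constructor <;> linarith [hy.1, hy.2, this.1, this.2]
  have hvol : volume (⋃ k ∈ hfin.toFinset, Set.Ico ((k : ℝ) / N) (((k : ℝ) + 1) / N))
      = ENNReal.ofReal ((#hfin.toFinset : ℝ) / N) := by
    rw [measure_biUnion_finset (fun k _ l _ h => disjoint_grid_Ico hN h)
      (fun _ _ => measurableSet_Ico)]
    simp only [Real.volume_Ico]
    rw [← ENNReal.ofReal_sum_of_nonneg]
    · rw [sum_grid_lengths, one_mul]
    · intro k _
      rw [show ((k : ℝ) + 1) / N - k / N = 1 / N by ring]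
      positivity
  have hreal : volume.real (⋃ k ∈ hfin.toFinset, Set.Ico ((k : ℝ) / N) (((k : ℝ) + 1) / N))
      = (#hfin.toFinset : ℝ) / N := by
    rw [measureReal_def, hvol, ENNReal.toReal_ofReal (by positivity)]
  refine ⟨hfin.toFinset, hcover, hsub, ?_, ?_⟩
  · rw [← hreal]
    exact measureReal_mono hcover (by rw [hvol]; exact ENNReal.ofReal_ne_top)
  · rw [← hreal]
    refine measureReal_mono (Set.iUnion₂_subset fun k hk => Set.Ico_subset_Icc_self.trans (hsub k hk))
      ?_
    exact (hK.isBounded.cthickening).measure_lt_top.ne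

/-- A finite union of compact intervals is closed, so it covers the closure as well; conversely,
grid covers of the compact closure have lengths tending to its measure. -/
theorem jordanOuter_eq {S : Set ℝ} (hS : Bornology.IsBounded S) :
    jordanOuter S = volume.real (closure S) := by
  have hK : IsCompact (closure S) := hS.isCompact_closure
  have hlow : ∀ s ∈ {s : ℝ | ∃ F : Finset (ℝ × ℝ), (∀ I ∈ F, I.1 ≤ I.2) ∧
      S ⊆ ⋃ I ∈ F, Set.Icc I.1 I.2 ∧ s = ∑ I ∈ F, (I.2 - I.1)}, volume.real (closure S) ≤ s := by
    rintro s ⟨F, hF, hcov, rfl⟩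
    have hcl : closure S ⊆ ⋃ I ∈ F, Set.Icc I.1 I.2 :=
      closure_minimal hcov (isClosed_biUnion_finset fun _ _ => isClosed_Icc)
    have h1 : volume (closure S) ≤ ENNReal.ofReal (∑ I ∈ F, (I.2 - I.1)) := by
      refine (measure_mono hcl).trans ((measure_biUnion_finset_le _ _).trans ?_)
      simp only [Real.volume_Icc]
      rw [ENNReal.ofReal_sum_of_nonneg fun I hI => sub_nonneg.2 (hF I hI)]
    exact ENNReal.toReal_le_of_le_ofReal (sum_nonneg fun I hI => sub_nonneg.2 (hF I hI)) h1
  have hgrid : ∀ N : ℕ, 0 < N →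
      jordanOuter S ≤ volume.real (Metric.cthickening (1 / N) (closure S)) := by
    intro N hN
    obtain ⟨F, h1, h2, h3, h4⟩ := exists_grid_cover hK hN
    refine le_trans ?_ h4
    refine csInf_le ⟨_, hlow⟩ ⟨F.image (gridInterval N), ?_, ?_, ?_⟩
    · intro I hI
      obtain ⟨k, _, rfl⟩ := mem_image.1 hI
      simp only [gridInterval]
      gcongr
      linarith
    · rw [set_biUnion_finset_image]
      exact subset_closure.trans (h1.trans (Set.iUnion₂_mono fun k _ => Set.Ico_subset_Icc_self))
    · rw [sum_image fun k _ l _ h => gridInterval_injective hN h]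
      simp only [gridInterval]
      rw [sum_grid_lengths, one_mul]
  refine le_antisymm ?_ ?_
  · have hlim := tendsto_measure_cthickening_of_isCompact (μ := volume) hK
    have hlim2 : Filter.Tendsto (fun N : ℕ => volume.real (Metric.cthickening (1 / N) (closure S)))
        Filter.atTop (𝓝 (volume.real (closure S))) :=
      (ENNReal.tendsto_toReal hK.measure_lt_top.ne).comp
        (hlim.comp (tendsto_const_div_atTop_nhds_zero_nat (1 : ℝ)))
    refine ge_of_tendsto hlim2 ?_
    filter_upwards [Filter.eventually_gt_atTop 0] with N hN using hgrid N hN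
  -- The unit grid serves only to show that some cover exists, since the infimum of the empty set
  -- would be `0`.
  · obtain ⟨F, h1, h2, h3, h4⟩ := exists_grid_cover hK (N := 1) one_pos
    refine le_csInf ⟨_, F.image (gridInterval 1), ?_, ?_, rfl⟩ hlow
    · intro I hI
      obtain ⟨k, _, rfl⟩ := mem_image.1 hI
      simp only [gridInterval]
      gcongr
      linarith
    · rw [set_biUnion_finset_image]
      exact subset_closure.trans (h1.trans (Set.iUnion₂_mono fun k _ => Set.Ico_subset_Icc_self))

theorem jordanInner_eq {S : Set ℝ} (hS : Bornology.IsBounded S) :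
    jordanInner S = volume.real (interior S) := by
  have hfin : volume (interior S) ≠ ⊤ := (hS.subset interior_subset).measure_lt_top.ne
  have hup : ∀ s ∈ {s : ℝ | ∃ F : Finset (ℝ × ℝ), (∀ I ∈ F, I.1 ≤ I.2) ∧
      (F : Set (ℝ × ℝ)).PairwiseDisjoint (fun I => Set.Icc I.1 I.2) ∧
      (⋃ I ∈ F, Set.Icc I.1 I.2) ⊆ S ∧ s = ∑ I ∈ F, (I.2 - I.1)},
      s ≤ volume.real (interior S) := by
    rintro s ⟨F, hF, hdisj, hsub, rfl⟩
    have hint : (⋃ I ∈ F, Set.Ioo I.1 I.2) ⊆ interior S :=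
      interior_maximal ((Set.iUnion₂_mono fun I _ => Set.Ioo_subset_Icc_self).trans hsub)
        (isOpen_biUnion fun _ _ => isOpen_Ioo)
    have hvol : volume (⋃ I ∈ F, Set.Ioo I.1 I.2) = ENNReal.ofReal (∑ I ∈ F, (I.2 - I.1)) := by
      rw [measure_biUnion_finset
        (fun I hI J hJ h => (hdisj hI hJ h).mono Set.Ioo_subset_Icc_self Set.Ioo_subset_Icc_self)
        (fun _ _ => measurableSet_Ioo), ENNReal.ofReal_sum_of_nonneg
          fun I hI => sub_nonneg.2 (hF I hI)]
      simp only [Real.volume_Ioo]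
    have := measureReal_mono (μ := volume) hint hfin
    rwa [measureReal_def, hvol, ENNReal.toReal_ofReal
      (sum_nonneg fun I hI => sub_nonneg.2 (hF I hI))] at this
  refine le_antisymm (csSup_le ⟨0, ∅, by simp⟩ hup) ?_
  -- Adjacent closed cells share an endpoint, so each is shortened by the factor `1 - η` to make the
  -- family disjoint; `η` tends to `0` afterwards.
  have hcomp : ∀ K ⊆ interior S, IsCompact K → ∀ η ∈ Set.Ioo (0 : ℝ) 1,
      (1 - η) * volume.real K ≤ jordanInner S := by
    intro K hKS hK η hη
    obtain ⟨δ, hδ, hδS⟩ := hK.exists_cthickening_subset_open isOpen_interior hKS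
    obtain ⟨M, hM⟩ := exists_nat_one_div_lt hδ
    set N := M + 1 with hNdef
    have hN : 0 < N := by omega
    have hN' : (0 : ℝ) < N := by exact_mod_cast hN
    have hNδ : 1 / (N : ℝ) ≤ δ := by rw [hNdef]; push_cast; exact hM.le
    obtain ⟨F, h1, h2, h3, h4⟩ := exists_grid_cover hK hN
    have hη0 : 0 < (1 - η) := by linarith [hη.2]
    have hsmall : ∀ k : ℤ, Set.Icc ((k : ℝ) / N) (((k : ℝ) + (1 - η)) / N) ⊆
        Set.Ico ((k : ℝ) / N) (((k : ℝ) + 1) / N) := by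
      intro k
      refine Set.Icc_subset_Ico_right ?_
      gcongr
      linarith [hη.1]
    have hinj : Function.Injective fun k : ℤ => ((k : ℝ) / N, ((k : ℝ) + (1 - η)) / N) := by
      intro k l h
      have := congrArg Prod.fst h
      simp only at this
      rw [div_left_inj' hN'.ne'] at this
      exact_mod_cast this
    refine le_trans (mul_le_mul_of_nonneg_left h3 hη0.le) ?_
    refine le_csSup ⟨_, hup⟩
      ⟨F.image fun k : ℤ => ((k : ℝ) / N, ((k : ℝ) + (1 - η)) / N), ?_, ?_, ?_, ?_⟩
    · intro I hI
      obtain ⟨k, _, rfl⟩ := mem_image.1 hI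
      simp only
      gcongr
      linarith
    · intro I hI J hJ h
      obtain ⟨k, _, rfl⟩ := mem_image.1 (mem_coe.1 hI)
      obtain ⟨l, _, rfl⟩ := mem_image.1 (mem_coe.1 hJ)
      have hkl : k ≠ l := by rintro rfl; exact h rfl
      exact (disjoint_grid_Ico hN hkl).mono (hsmall k) (hsmall l)
    · rw [set_biUnion_finset_image]
      refine Set.iUnion₂_subset fun k hk => ?_
      exact (hsmall k).trans (Set.Ico_subset_Icc_self.trans ((h2 k hk).trans
        ((Metric.cthickening_mono hNδ K).trans (hδS.trans interior_subset))))
    · rw [sum_image fun k _ l _ h => hinj h]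
      exact (sum_grid_lengths F N (1 - η)).symm
  have hcomp' : ∀ K ⊆ interior S, IsCompact K → volume.real K ≤ jordanInner S := by
    intro K hKS hK
    have hlim : Filter.Tendsto (fun η : ℝ => (1 - η) * volume.real K) (𝓝[>] 0)
        (𝓝 (volume.real K)) := by
      have : Filter.Tendsto (fun η : ℝ => (1 - η) * volume.real K) (𝓝 0)
          (𝓝 ((1 - 0) * volume.real K)) := Continuous.tendsto (by fun_prop) 0
      rw [sub_zero, one_mul] at this
      exact this.mono_left nhdsWithin_le_nhds
    refine le_of_tendsto hlim ?_
    filter_upwards [Ioo_mem_nhdsGT (one_pos : (0 : ℝ) < 1)] with η hη using hcomp K hKS hK η hη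
  have h0 : 0 ≤ jordanInner S := by
    simpa using hcomp' ∅ (Set.empty_subset _) isCompact_empty
  by_contra! hlt
  have : ENNReal.ofReal (jordanInner S) < volume (interior S) :=
    (ENNReal.ofReal_lt_iff_lt_toReal h0 hfin).2 hlt
  obtain ⟨K, hKS, hK, hlt'⟩ := isOpen_interior.exists_lt_isCompact this
  have h1 := hcomp' K hKS hK
  have h2 := (ENNReal.ofReal_lt_iff_lt_toReal h0 hK.measure_lt_top.ne).1 hlt'
  exact absurd h1 (not_le.2 h2)

theorem jordanInner_eq_jordanOuter_iff {S : Set ℝ} (hS : Bornology.IsBounded S) :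
    jordanInner S = jordanOuter S ↔ volume (frontier S) = 0 := by
  have hfin : volume (closure S) ≠ ⊤ := hS.isCompact_closure.measure_lt_top.ne
  have hsub : interior S ⊆ closure S := interior_subset.trans subset_closure
  have hfin' : volume (frontier S) ≠ ⊤ := ne_top_of_le_ne_top hfin (measure_mono frontier_subset_closure)
  have h := measureReal_sdiff (μ := volume) hsub isOpen_interior.measurableSet hfin
  rw [← measureReal_eq_zero_iff hfin', frontier, h, jordanInner_eq hS, jordanOuter_eq hS,
    sub_eq_zero, eq_comm]

theorem isJordanMeasurable_iff {A : Set ℝ} : IsJordanMeasurable A ↔ volume (frontier A) = 0 := by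
  have hb : ∀ a b : ℝ, Bornology.IsBounded (A ∩ Set.Icc a b) := fun a b =>
    (Metric.isBounded_Icc a b).subset Set.inter_subset_right
  constructor
  · intro h
    have hsub : frontier A ⊆ ⋃ n : ℕ, frontier (A ∩ Set.Icc (-(n : ℝ)) n) := by
      intro x hx
      obtain ⟨n, hn⟩ := exists_nat_gt |x|
      rw [abs_lt] at hn
      refine Set.mem_iUnion.2 ⟨n, ?_, fun hi => hx.2 (interior_mono Set.inter_subset_left hi)⟩
      refine closure_mono (Set.inter_subset_inter_right A Set.Ioo_subset_Icc_self) ?_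
      rw [Set.inter_comm]
      exact isOpen_Ioo.inter_closure ⟨hn, hx.1⟩
    refine measure_mono_null hsub (measure_iUnion_null fun n => ?_)
    exact (jordanInner_eq_jordanOuter_iff (hb _ _)).1 (h _ _)
  · intro h a b
    rw [jordanInner_eq_jordanOuter_iff (hb a b)]
    refine measure_mono_null (frontier_inter_subset A (Set.Icc a b)) (measure_union_null ?_ ?_)
    · exact measure_mono_null Set.inter_subset_left h
    · exact measure_mono_null Set.inter_subset_right ((convex_Icc a b).addHaar_frontier volume)

theorem jordanMeasure_eq {B : Set ℝ} (hB : Bornology.IsBounded B) (h : IsJordanMeasurable B) :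
    jordanMeasure B = volume.real (interior B) := by
  rw [jordanMeasure, ← (jordanInner_eq_jordanOuter_iff hB).2 (isJordanMeasurable_iff.1 h),
    jordanInner_eq hB]

/-! ### Preimages under `g` -/

theorem gPreimage_subset (A : Set ℝ) : gPreimage A ⊆ Set.Ioo 0 1 := fun _ hx => hx.1

theorem gPreimage_mono {A B : Set ℝ} (h : A ⊆ B) : gPreimage A ⊆ gPreimage B :=
  fun _ hx => ⟨hx.1, h hx.2⟩

theorem isOpen_gPreimage {U : Set ℝ} (hU : IsOpen U) : IsOpen (gPreimage U) :=
  continuousOn_g.isOpen_inter_preimage isOpen_Ioo hU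

/-- The inverse of `g` is `2π`-Lipschitz on the range of `g`, and Lipschitz maps do not create
one-dimensional Hausdorff measure, which on the line is Lebesgue measure. -/
theorem volume_gPreimage_eq_zero {E : Set ℝ} (hE : volume E = 0) : volume (gPreimage E) = 0 := by
  have hinv : ∀ x ∈ Set.Ioo (0 : ℝ) 1, Function.invFunOn g (Set.Ioo 0 1) (g x) = x :=
    fun x hx => g_injOn.leftInvOn_invFunOn hx
  have hlip : LipschitzOnWith (Real.toNNReal (2 * π)) (Function.invFunOn g (Set.Ioo 0 1))
      (g '' Set.Ioo 0 1) := by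
    refine LipschitzOnWith.of_dist_le_mul ?_
    rintro _ ⟨x, hx, rfl⟩ _ ⟨y, hy, rfl⟩
    rw [hinv x hx, hinv y hy, Real.dist_eq, Real.dist_eq, Real.coe_toNNReal _ (by positivity)]
    exact abs_sub_le_abs_g_sub hx hy
  have hsub : gPreimage E ⊆ Function.invFunOn g (Set.Ioo 0 1) '' (E ∩ g '' Set.Ioo 0 1) :=
    fun x hx => ⟨g x, ⟨hx.2, x, hx.1, rfl⟩, hinv x hx.1⟩
  refine measure_mono_null hsub ?_
  have h := (hlip.mono Set.inter_subset_right).hausdorffMeasure_image_le (s := E ∩ g '' Set.Ioo 0 1)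
    (d := 1) zero_le_one
  rw [hausdorffMeasure_real, measure_mono_null Set.inter_subset_left hE, mul_zero] at h
  exact le_antisymm h zero_le

theorem frontier_gPreimage_subset (A : Set ℝ) :
    frontier (gPreimage A) ⊆ frontier (Set.Ioo (0 : ℝ) 1) ∪ gPreimage (frontier A) := by
  intro x hx
  by_cases hxI : x ∈ Set.Ioo (0 : ℝ) 1
  · refine Or.inr ⟨hxI, ?_, fun hi => hx.2 ?_⟩
    · by_contra hc
      have hopen := isOpen_gPreimage (isClosed_closure (s := A)).isOpen_compl
      obtain ⟨y, hy1, hy2⟩ := mem_closure_iff.1 hx.1 _ hopen ⟨hxI, hc⟩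
      exact hy1.2 (subset_closure hy2.2)
    · exact interior_maximal (gPreimage_mono interior_subset)
        (isOpen_gPreimage isOpen_interior) (show x ∈ gPreimage (interior A) from ⟨hxI, hi⟩)
  · exact Or.inl (show x ∈ frontier _ from
      ⟨closure_mono (gPreimage_subset A) hx.1, fun h => hxI (interior_subset h)⟩)

theorem isJordanMeasurable_gPreimage {A : Set ℝ} (hA : IsJordanMeasurable A) :
    IsJordanMeasurable (gPreimage A) := by
  rw [isJordanMeasurable_iff] at hA ⊢
  refine measure_mono_null (frontier_gPreimage_subset A) (measure_union_null ?_ ?_)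
  · exact (convex_Ioo (0 : ℝ) 1).addHaar_frontier volume
  · exact volume_gPreimage_eq_zero hA

/-! ### Equidistribution -/

/-- The averages of `f` along the orbit `a + b, 2 a + b, …` in the circle. -/
noncomputable def orbitAverage (a b : UnitAddCircle) (f : UnitAddCircle → ℂ) (N : ℕ) : ℂ :=
  (∑ n ∈ Icc 1 N, f (n • a + b)) / N

theorem fourier_nsmul_add (m : ℤ) (a b : UnitAddCircle) (n : ℕ) :
    fourier m (n • a + b) = fourier m a ^ n * fourier m b := by
  simp only [fourier_apply, smul_add, AddCircle.toCircle_add, smul_comm m n a,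
    AddCircle.toCircle_nsmul, Circle.coe_mul, Circle.coe_pow]

theorem integral_fourier_eq (m : ℤ) :
    ∫ x : UnitAddCircle, fourier m x ∂AddCircle.haarAddCircle = if m = 0 then 1 else 0 := by
  have h := congrFun (fourierCoeff_fourier (T := 1) m) 0
  rw [fourierCoeff] at h
  simp only [neg_zero, fourier_zero, one_smul] at h
  rw [h, Pi.single_apply]
  simp [eq_comm]

/-- For `m ≠ 0` the sum is geometric with ratio `z ≠ 1` on the unit circle, hence bounded in `N`.
Infinite order of `a` is what excludes `z = 1`. -/
theorem tendsto_orbitAverage_fourier {a : UnitAddCircle} (ha : ∀ m : ℤ, m • a = 0 → m = 0)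
    (b : UnitAddCircle) (m : ℤ) :
    Filter.Tendsto (orbitAverage a b (fourier m)) Filter.atTop
      (𝓝 (∫ x : UnitAddCircle, fourier m x ∂AddCircle.haarAddCircle)) := by
  rw [integral_fourier_eq]
  split_ifs with hm
  · subst hm
    refine tendsto_const_nhds.congr' ?_
    filter_upwards [Filter.eventually_gt_atTop 0] with N hN
    have : (N : ℂ) ≠ 0 := by exact_mod_cast hN.ne'
    simp [orbitAverage, this]
  · set z : ℂ := fourier m a with hz
    have hz1 : z ≠ 1 := by
      intro h
      apply hm
      apply ha
      rw [hz, fourier_apply] at h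
      have h' : AddCircle.toCircle (m • a) = AddCircle.toCircle (0 : UnitAddCircle) := by
        rw [AddCircle.toCircle_zero]
        exact Circle.ext (by simpa using h)
      exact AddCircle.injective_toCircle one_ne_zero h'
    have hnorm : ∀ x : UnitAddCircle, ‖(fourier m x : ℂ)‖ = 1 := fun x => by
      rw [fourier_apply]; exact Circle.norm_coe _
    have hsum : ∀ N : ℕ, ‖∑ n ∈ Icc 1 N, (fourier m (n • a + b) : ℂ)‖ ≤ 2 / ‖z - 1‖ := by
      intro N
      simp only [fourier_nsmul_add, ← hz]
      rw [← sum_mul, norm_mul, hnorm, mul_one]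
      have e : ∑ n ∈ Icc 1 N, z ^ n = z * ((z ^ N - 1) / (z - 1)) := by
        rw [← geom_sum_eq hz1]
        induction N with
        | zero => simp
        | succ N ih => rw [sum_Icc_succ_top (by omega), ih, sum_range_succ, mul_add, pow_succ']
      rw [e, norm_mul, hnorm, one_mul, norm_div]
      gcongr
      refine (norm_sub_le _ _).trans ?_
      rw [norm_pow, hz, hnorm]
      norm_num
    rw [tendsto_zero_iff_norm_tendsto_zero]
    refine squeeze_zero (fun _ => norm_nonneg _) (fun N => ?_)
      (tendsto_const_div_atTop_nhds_zero_nat (2 / ‖z - 1‖))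
    rw [orbitAverage, norm_div, Complex.norm_natCast]
    exact div_le_div_of_nonneg_right (hsum N) (Nat.cast_nonneg N)

theorem norm_orbitAverage_le (a b : UnitAddCircle) {f : UnitAddCircle → ℂ} {C : ℝ} (hC : 0 ≤ C)
    (hf : ∀ x, ‖f x‖ ≤ C) (N : ℕ) : ‖orbitAverage a b f N‖ ≤ C := by
  rcases Nat.eq_zero_or_pos N with rfl | hN
  · simpa [orbitAverage] using hC
  · have hN' : (0 : ℝ) < N := by exact_mod_cast hN
    rw [orbitAverage, norm_div, Complex.norm_natCast, div_le_iff₀ hN']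
    refine (norm_sum_le_of_le _ (f := fun n : ℕ => f (n • a + b)) (n := fun _ => C)
      fun n _ => hf _).trans_eq ?_
    simp [mul_comm]

theorem integrable_haarAddCircle (f : C(UnitAddCircle, ℂ)) :
    Integrable f AddCircle.haarAddCircle :=
  f.continuous.integrable_of_hasCompactSupport (HasCompactSupport.of_compactSpace f)

/-- Weyl's equidistribution theorem for irrational rotations of the circle. -/
theorem tendsto_orbitAverage {a : UnitAddCircle} (ha : ∀ m : ℤ, m • a = 0 → m = 0)
    (b : UnitAddCircle) (f : C(UnitAddCircle, ℂ)) :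
    Filter.Tendsto (orbitAverage a b f) Filter.atTop
      (𝓝 (∫ x : UnitAddCircle, f x ∂AddCircle.haarAddCircle)) := by
  have hspan : ∀ h ∈ Submodule.span ℂ (Set.range (@fourier 1)),
      Filter.Tendsto (orbitAverage a b h) Filter.atTop
        (𝓝 (∫ x : UnitAddCircle, h x ∂AddCircle.haarAddCircle)) := by
    intro h hh
    induction hh using Submodule.span_induction with
    | mem h hmem =>
      obtain ⟨m, rfl⟩ := hmem
      exact tendsto_orbitAverage_fourier ha b m
    | zero =>
      simp only [ContinuousMap.coe_zero, Pi.zero_apply, integral_zero]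
      refine tendsto_const_nhds.congr fun N => ?_
      simp [orbitAverage]
    | add h k _ _ ih ik =>
      have e : ∫ x : UnitAddCircle, (h + k) x ∂AddCircle.haarAddCircle =
          (∫ x, h x ∂AddCircle.haarAddCircle) + ∫ x, k x ∂AddCircle.haarAddCircle :=
        integral_add (integrable_haarAddCircle h) (integrable_haarAddCircle k)
      rw [e]
      refine (ih.add ik).congr fun N => ?_
      simp [orbitAverage, sum_add_distrib, add_div]
    | smul c h _ ih =>
      have e : ∫ x : UnitAddCircle, (c • h) x ∂AddCircle.haarAddCircle =
          c * ∫ x, h x ∂AddCircle.haarAddCircle := integral_const_mul c _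
      rw [e]
      refine (ih.const_mul c).congr fun N => ?_
      simp [orbitAverage, ← mul_sum, mul_div_assoc]
  rw [Metric.tendsto_atTop']
  intro ε hε
  -- Trigonometric polynomials are uniformly dense, and replacing `f` by one within `ε / 4` changes
  -- the averages and the integral by at most `ε / 4` each.
  have hf : f ∈ (Submodule.span ℂ (Set.range (@fourier 1))).topologicalClosure := by
    rw [span_fourier_closure_eq_top]; trivial
  obtain ⟨h, hh, hfh⟩ := Metric.mem_closure_iff.1 hf (ε / 4) (by linarith)
  obtain ⟨N₀, hN₀⟩ := Metric.tendsto_atTop'.1 (hspan h hh) (ε / 4) (by linarith)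
  refine ⟨N₀, fun N hN => ?_⟩
  have h1 := hN₀ N hN
  have hb : ∀ x, ‖(f - h) x‖ ≤ ε / 4 := fun x => by
    refine ((f - h).norm_coe_le_norm x).trans ?_
    rw [← dist_eq_norm]
    exact hfh.le
  have h2 : ‖orbitAverage a b f N - orbitAverage a b h N‖ ≤ ε / 4 := by
    have e : orbitAverage a b f N - orbitAverage a b h N = orbitAverage a b (f - h) N := by
      simp [orbitAverage, sum_sub_distrib, sub_div]
    rw [e]
    exact norm_orbitAverage_le a b (by linarith) hb N
  have h3 : ‖(∫ x : UnitAddCircle, h x ∂AddCircle.haarAddCircle) -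
      ∫ x : UnitAddCircle, f x ∂AddCircle.haarAddCircle‖ ≤ ε / 4 := by
    rw [← integral_sub (integrable_haarAddCircle h) (integrable_haarAddCircle f)]
    refine (norm_integral_le_of_norm_le_const (C := ε / 4)
      (Filter.Eventually.of_forall fun x => ?_)).trans_eq ?_
    · rw [norm_sub_rev]; exact hb x
    · simp
  rw [dist_eq_norm] at h1 ⊢
  have e : orbitAverage a b f N - ∫ x : UnitAddCircle, f x ∂AddCircle.haarAddCircle
      = (orbitAverage a b f N - orbitAverage a b h N) +
        (orbitAverage a b h N - ∫ x : UnitAddCircle, h x ∂AddCircle.haarAddCircle) +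
        ((∫ x : UnitAddCircle, h x ∂AddCircle.haarAddCircle) -
          ∫ x : UnitAddCircle, f x ∂AddCircle.haarAddCircle) := by ring
  rw [e]
  refine (norm_add₃_le).trans_lt ?_
  linarith

theorem volume_unitAddCircle_eq :
    (volume : Measure UnitAddCircle) = AddCircle.haarAddCircle := by
  rw [AddCircle.volume_eq_smul_haarAddCircle]
  simp

/-- Inner regularity gives a compact `K` inside `U` of almost full measure, and a Urysohn function
between the two is averaged. Only this one-sided bound is needed later. -/
theorem le_proportion_orbit_mem {a : UnitAddCircle} (ha : ∀ m : ℤ, m • a = 0 → m = 0)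
    (b : UnitAddCircle) {U : Set UnitAddCircle} (hU : IsOpen U) :
    ∀ η > 0, ∀ᶠ N in Filter.atTop,
      volume.real U - η ≤ proportion {n | n • a + b ∈ U} N := by
  intro η hη
  obtain ⟨K, hKU, hK, hlt⟩ : ∃ K ⊆ U, IsCompact K ∧ volume.real U - η < volume.real K := by
    rcases lt_or_ge (volume.real U - η) 0 with h | h
    · exact ⟨∅, Set.empty_subset _, isCompact_empty, by simpa using h⟩
    · have hfin : volume U ≠ ⊤ := measure_ne_top _ _
      have : ENNReal.ofReal (volume.real U - η) < volume U := by
        rw [ENNReal.ofReal_lt_iff_lt_toReal h hfin]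
        exact sub_lt_self _ hη
      obtain ⟨K, hKU, hK, hlt⟩ := hU.exists_lt_isCompact this
      exact ⟨K, hKU, hK, (ENNReal.ofReal_lt_iff_lt_toReal h (measure_ne_top _ _)).1 hlt⟩
  obtain ⟨f, hf1, hf0, -, hf⟩ := exists_continuous_one_zero_of_isCompact hK hU.isClosed_compl
    (Set.disjoint_compl_right_iff_subset.2 hKU)
  let F : C(UnitAddCircle, ℂ) := ⟨fun x => (f x : ℂ), by fun_prop⟩
  have hlim := (Complex.continuous_re.tendsto _).comp (tendsto_orbitAverage ha b F)
  have hint : (∫ x : UnitAddCircle, F x ∂AddCircle.haarAddCircle).re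
      = ∫ x : UnitAddCircle, f x ∂AddCircle.haarAddCircle := by
    have : ∫ x : UnitAddCircle, F x ∂AddCircle.haarAddCircle
      = ((∫ x : UnitAddCircle, f x ∂AddCircle.haarAddCircle : ℝ) : ℂ) := integral_ofReal
    rw [this, Complex.ofReal_re]
  have hfi : Integrable f (AddCircle.haarAddCircle (T := 1)) :=
    f.continuous.integrable_of_hasCompactSupport (HasCompactSupport.of_compactSpace f)
  have hKint : volume.real K ≤ ∫ x : UnitAddCircle, f x ∂AddCircle.haarAddCircle := by
    rw [volume_unitAddCircle_eq, ← integral_indicator_one hK.measurableSet]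
    refine integral_mono ?_ hfi fun x => ?_
    · exact (integrable_const (1 : ℝ)).indicator hK.measurableSet
    · by_cases hx : x ∈ K
      · rw [Set.indicator_of_mem hx, hf1 hx]
      · rw [Set.indicator_of_notMem hx]; exact (hf x).1
  rw [hint] at hlim
  filter_upwards [hlim.eventually_const_lt (hlt.trans_le hKint)] with N hN
  refine hN.le.trans ?_
  have hre : (orbitAverage a b F N).re = (∑ n ∈ Icc 1 N, f (n • a + b)) / N := by
    have : orbitAverage a b F N = (((∑ n ∈ Icc 1 N, f (n • a + b)) / N : ℝ) : ℂ) := by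
      simp [orbitAverage, F]
    rw [this, Complex.ofReal_re]
  simp only [Function.comp_apply]
  rw [hre, proportion]
  refine div_le_div_of_nonneg_right ?_ (Nat.cast_nonneg N)
  classical
  have e : ({n | n • a + b ∈ U} ∩ Set.Icc 1 N) = ↑((Icc 1 N).filter fun n => n • a + b ∈ U) := by
    ext n
    simp [and_comm]
  rw [e, Set.ncard_coe_finset, card_filter]
  push_cast
  refine sum_le_sum fun n _ => ?_
  split_ifs with h
  · exact (hf _).2
  · exact (hf0 h).le

/-! ### Irrational angles -/

/-- The phase is the representative in `[0, 1)` of the orbit of `θ / π` started at `1 / 2`. Since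
`G` lies in the unit interval, passing to the circle is injective on `G` and loses no measure. -/
theorem le_proportion_phase_mem {θ : ℝ} (hθ : Irrational (θ / π)) {G : Set ℝ} (hG : IsOpen G)
    (hG1 : G ⊆ Set.Ioo 0 1) :
    ∀ η > 0, ∀ᶠ N in Filter.atTop, volume.real G - η ≤ proportion {n | phase θ n ∈ G} N := by
  set a : UnitAddCircle := ((θ / π : ℝ) : UnitAddCircle) with ha
  have ha0 : ∀ m : ℤ, m • a = 0 → m = 0 := by
    intro m hm
    by_contra hne
    rw [ha, ← AddCircle.coe_zsmul, AddCircle.coe_eq_zero_iff] at hm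
    obtain ⟨k, hk⟩ := hm
    simp only [zsmul_eq_mul, mul_one] at hk
    exact (hθ.intCast_mul hne).ne_int k hk.symm
  have hU : IsOpen ((fun x : ℝ => (x : UnitAddCircle)) '' G) :=
    QuotientAddGroup.isOpenMap_coe G hG
  have hmem : ∀ n : ℕ, n • a + ((1 / 2 : ℝ) : UnitAddCircle) ∈ (fun x : ℝ => (x : UnitAddCircle)) '' G →
      phase θ n ∈ G := by
    rintro n ⟨y, hy, hyn⟩
    have e : n • a + ((1 / 2 : ℝ) : UnitAddCircle)
        = ((n * (θ / π) + 1 / 2 : ℝ) : UnitAddCircle) := by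
      rw [ha, ← AddCircle.coe_nsmul, ← AddCircle.coe_add, nsmul_eq_mul]
    simp only [e] at hyn
    have h := AddCircle.coe_eq_zero_iff (1 : ℝ) (x := n * (θ / π) + 1 / 2 - y) |>.1
      (by rw [AddCircle.coe_sub, hyn, sub_self])
    obtain ⟨k, hk⟩ := h
    simp only [zsmul_eq_mul, mul_one] at hk
    have : phase θ n = y := by
      rw [phase, Int.fract_eq_iff]
      exact ⟨(hG1 hy).1.le, (hG1 hy).2, k, hk.symm⟩
    rwa [this]
  have hvol : volume.real G ≤ volume.real ((fun x : ℝ => (x : UnitAddCircle)) '' G) := by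
    have hmp := (UnitAddCircle.measurePreserving_mk 0).measure_preimage
      hU.measurableSet.nullMeasurableSet
    refine ENNReal.toReal_mono (measure_ne_top _ _) ?_
    rw [← hmp, zero_add]
    refine le_trans ?_ (Measure.le_restrict_apply _ _)
    exact measure_mono fun x hx => ⟨⟨x, hx, rfl⟩, Set.Ioo_subset_Ioc_self (hG1 hx)⟩
  intro η hη
  filter_upwards [le_proportion_orbit_mem ha0 ((1 / 2 : ℝ) : UnitAddCircle) hU (η / 2) (by linarith),
    proportion_le_add (K := {n | n • a + ((1 / 2 : ℝ) : UnitAddCircle) ∈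
      (fun x : ℝ => (x : UnitAddCircle)) '' G}) (K' := {n | phase θ n ∈ G})
      (Filter.Eventually.of_forall hmem) (η / 2) (by linarith)] with N h1 h2
  linarith

theorem phase_ne_zero_of_irrational {θ : ℝ} (hθ : Irrational (θ / π)) {n : ℕ} (hn : 0 < n) :
    phase θ n ≠ 0 := by
  intro h
  obtain ⟨z, hz⟩ := Int.fract_eq_zero_iff.1 h
  have h1 : θ / π = ((z : ℚ) - 1 / 2) / n := by
    have hn' : (n : ℝ) ≠ 0 := by positivity
    push_cast
    rw [eq_div_iff hn']
    linarith
  exact hθ ⟨((z : ℚ) - 1 / 2) / n, by rw [h1]; push_cast; ring⟩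

/-! ### The index relative to a set: its interior and its exterior -/

theorem mem_add_Ioo_iff {A : Set ℝ} {x ε : ℝ} :
    x ∈ A + Set.Ioo (-ε) ε ↔ ∃ y ∈ A, |x - y| < ε := by
  rw [Set.mem_add]
  constructor
  · rintro ⟨y, hy, z, hz, rfl⟩
    exact ⟨y, hy, by rw [add_sub_cancel_left]; exact abs_lt.2 hz⟩
  · rintro ⟨y, hy, h⟩
    exact ⟨y, hy, x - y, abs_lt.1 h, by ring⟩

/-- The points at distance more than `ε` from `A`. -/
def farFrom (A : Set ℝ) (ε : ℝ) : Set ℝ := (Metric.cthickening ε A)ᶜ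

theorem isOpen_farFrom (A : Set ℝ) (ε : ℝ) : IsOpen (farFrom A ε) :=
  Metric.isClosed_cthickening.isOpen_compl

theorem lt_abs_sub_of_mem_farFrom {A : Set ℝ} {ε x y : ℝ} (hx : x ∈ farFrom A ε) (hy : y ∈ A) :
    ε < |x - y| := by
  by_contra! h
  exact hx (Metric.mem_cthickening_of_dist_le x y ε A hy (by rwa [Real.dist_eq]))

theorem iUnion_farFrom (A : Set ℝ) :
    ⋃ k : ℕ, farFrom A (1 / ((k : ℝ) + 1)) = (closure A)ᶜ := by
  rw [Metric.closure_eq_iInter_cthickening' A (Set.range fun k : ℕ => 1 / ((k : ℝ) + 1))]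
  · simp [farFrom, Set.compl_iInter]
  · intro ε hε
    obtain ⟨k, hk⟩ := exists_nat_one_div_lt hε
    exact ⟨_, ⟨k, rfl⟩, by positivity, hk.le⟩

theorem tendsto_volume_gPreimage_farFrom (A : Set ℝ) :
    Filter.Tendsto (fun k : ℕ => volume.real (gPreimage (farFrom A (1 / ((k : ℝ) + 1)))))
      Filter.atTop (𝓝 (volume.real (gPreimage (closure A)ᶜ))) := by
  have hmono : Monotone fun k : ℕ => gPreimage (farFrom A (1 / ((k : ℝ) + 1))) := by
    intro k l hkl
    refine gPreimage_mono (Set.compl_subset_compl.2 (Metric.cthickening_mono ?_ A))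
    have : (k : ℝ) ≤ l := by exact_mod_cast hkl
    gcongr
  have hU : ⋃ k : ℕ, gPreimage (farFrom A (1 / ((k : ℝ) + 1))) = gPreimage (closure A)ᶜ := by
    rw [← iUnion_farFrom]
    ext x
    simp [gPreimage]
  have h := tendsto_measure_iUnion_atTop (μ := volume) hmono
  rw [hU] at h
  refine (ENNReal.tendsto_toReal ?_).comp h
  exact ((Metric.isBounded_Ioo 0 1).subset (gPreimage_subset _)).measure_lt_top.ne

/-- The preimages of exterior, interior and frontier partition the unit interval, and the last is
null. This makes the two bounds on the index meet. -/
theorem volume_gPreimage_compl_closure {A : Set ℝ} (hA : volume (frontier A) = 0) :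
    volume.real (gPreimage (closure A)ᶜ) = 1 - volume.real (gPreimage (interior A)) := by
  have hfin : ∀ E, volume (gPreimage E) ≠ ⊤ := fun E =>
    ((Metric.isBounded_Ioo 0 1).subset (gPreimage_subset E)).measure_lt_top.ne
  have h1 : Set.Ioo (0 : ℝ) 1 =
      (gPreimage (closure A)ᶜ ∪ gPreimage (interior A)) ∪ gPreimage (frontier A) := by
    ext x
    change _ ↔ ((x ∈ Set.Ioo (0 : ℝ) 1 ∧ g x ∉ closure A) ∨
      (x ∈ Set.Ioo (0 : ℝ) 1 ∧ g x ∈ interior A)) ∨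
      (x ∈ Set.Ioo (0 : ℝ) 1 ∧ g x ∈ closure A ∧ g x ∉ interior A)
    tauto
  have hdisj : Disjoint (gPreimage (closure A)ᶜ) (gPreimage (interior A)) := by
    rw [Set.disjoint_left]
    exact fun x hx hx' => hx.2 (subset_closure (interior_subset hx'.2))
  have hnull : volume.real (gPreimage (frontier A)) = 0 := by
    rw [measureReal_def, volume_gPreimage_eq_zero hA, ENNReal.toReal_zero]
  have h2 := measureReal_union (μ := volume) hdisj (isOpen_gPreimage isOpen_interior).measurableSet
    (hfin _) (hfin _)
  have h3 : volume.real (Set.Ioo (0 : ℝ) 1) = 1 := by simp [measureReal_def]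
  have h4 := measureReal_union_le (μ := volume)
    (gPreimage (closure A)ᶜ ∪ gPreimage (interior A)) (gPreimage (frontier A))
  rw [← h1, h3, hnull, h2] at h4
  have h5 : volume.real (gPreimage (closure A)ᶜ ∪ gPreimage (interior A)) ≤ 1 := by
    rw [← h3]
    exact measureReal_mono (Set.union_subset (gPreimage_subset _) (gPreimage_subset _))
      (by simp)
  linarith

theorem jordanMeasure_gPreimage {A : Set ℝ} (hA : IsJordanMeasurable A) :
    jordanMeasure (gPreimage A) = volume.real (gPreimage (interior A)) := by
  have hb : Bornology.IsBounded (gPreimage A) :=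
    (Metric.isBounded_Ioo 0 1).subset (gPreimage_subset A)
  rw [jordanMeasure_eq hb (isJordanMeasurable_gPreimage hA)]
  refine le_antisymm ?_ ?_
  · have hsub : interior (gPreimage A) ⊆ gPreimage (interior A) ∪ gPreimage (frontier A) := by
      intro x hx
      obtain ⟨h1, h2⟩ := interior_subset hx
      by_cases h3 : g x ∈ interior A
      · exact Or.inl (show x ∈ gPreimage (interior A) from ⟨h1, h3⟩)
      · exact Or.inr (show x ∈ gPreimage (frontier A) from ⟨h1, subset_closure h2, h3⟩)
    have h4 := measureReal_mono (μ := volume) hsub (((Metric.isBounded_Ioo 0 1).subset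
      (Set.union_subset (gPreimage_subset _) (gPreimage_subset _))).measure_lt_top.ne)
    refine h4.trans ((measureReal_union_le _ _).trans_eq ?_)
    rw [measureReal_def volume (gPreimage (frontier A)),
      volume_gPreimage_eq_zero (isJordanMeasurable_iff.1 hA), ENNReal.toReal_zero, add_zero]
  · refine measureReal_mono ?_ ((hb.subset interior_subset).measure_lt_top.ne)
    exact interior_maximal (gPreimage_mono interior_subset) (isOpen_gPreimage isOpen_interior)

theorem setConvIndex_lagrangeOp {θ : ℝ} (d : ℝ) (hθ : θ ∈ Set.Ioo 0 π)
    (hirr : Irrational (θ / π)) {A : Set ℝ} (hA : IsJordanMeasurable A) :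
    setConvIndex (fun n => lagrangeOp n (stepFn (cos θ) d) (cos θ)) A
      = jordanMeasure (gPreimage A) := by
  have hnull := isJordanMeasurable_iff.1 hA
  set x : ℕ → ℝ := fun n => lagrangeOp n (stepFn (cos θ) d) (cos θ) with hx
  have hev : ∀ ε > 0, ∀ᶠ n in Filter.atTop,
      phase θ n ∈ Set.Ioo (0 : ℝ) 1 ∧ |x n - g (phase θ n)| < ε := by
    intro ε hε
    have h := (tendsto_order.1 (tendsto_lagrangeOp_stepFn_sub d hθ).abs).2 ε (by simpa using hε)
    filter_upwards [h, Filter.eventually_gt_atTop 0] with n h1 h2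
    have h3 := phase_ne_zero_of_irrational hirr h2
    rw [limitValue, if_neg h3] at h1
    exact ⟨phase_mem_Ioo h3, h1⟩
  have hup : ∀ ε : Set.Ioi (0 : ℝ),
      upperDensity {n | x n ∉ A + Set.Ioo (-(ε : ℝ)) (ε : ℝ)}
        ≤ 1 - volume.real (gPreimage (interior A)) := by
    intro ε
    refine upperDensity_le_of_eventually (G := {n | phase θ n ∈ gPreimage (interior A)}) ?_
      (le_proportion_phase_mem hirr (isOpen_gPreimage isOpen_interior) (gPreimage_subset _))
    filter_upwards [hev ε ε.2] with n hn h1 h2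
    exact h1 (mem_add_Ioo_iff.2 ⟨_, interior_subset h2.2, hn.2⟩)
  have hlow : ∀ k : ℕ, volume.real (gPreimage (farFrom A (1 / ((k : ℝ) + 1)))) ≤
      ⨆ ε : Set.Ioi (0 : ℝ), upperDensity {n | x n ∉ A + Set.Ioo (-(ε : ℝ)) (ε : ℝ)} := by
    intro k
    have hk : 0 < 1 / ((k : ℝ) + 1) := by positivity
    -- Half the distance is kept in reserve for the error between `x n` and `g (phase θ n)`.
    refine le_ciSup_of_le (bddAbove_upperDensity _) ⟨1 / ((k : ℝ) + 1) / 2, half_pos hk⟩ ?_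
    refine le_upperDensity_of_eventually
      (G := {n | phase θ n ∈ gPreimage (farFrom A (1 / ((k : ℝ) + 1)))}) ?_
      (le_proportion_phase_mem hirr (isOpen_gPreimage (isOpen_farFrom _ _)) (gPreimage_subset _))
    filter_upwards [hev _ (half_pos hk)] with n hn h1 h2
    obtain ⟨y, hy, hxy⟩ := mem_add_Ioo_iff.1 h2
    have h3 := lt_abs_sub_of_mem_farFrom h1.2 hy
    have h4 := abs_sub_le (g (phase θ n)) (x n) y
    rw [abs_sub_comm _ (x n)] at h4
    linarith [hn.2]
  have hsup : (⨆ ε : Set.Ioi (0 : ℝ), upperDensity {n | x n ∉ A + Set.Ioo (-(ε : ℝ)) (ε : ℝ)})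
      = 1 - volume.real (gPreimage (interior A)) := by
    have : Nonempty (Set.Ioi (0 : ℝ)) := ⟨⟨1, Set.mem_Ioi.2 one_pos⟩⟩
    refine le_antisymm (ciSup_le hup) ?_
    rw [← volume_gPreimage_compl_closure hnull]
    exact le_of_tendsto (tendsto_volume_gPreimage_farFrom A)
      (Filter.Eventually.of_forall hlow)
  rw [setConvIndex, hsup, jordanMeasure_gPreimage hA]
  ring

end LagrangeIndex

theorem theorem2p1 (θ₀ d : ℝ) (hθ₀ : θ₀ ∈ Set.Ioo 0 Real.pi) :
    -- uniform convergence on the compact subsets of `[-1,1] \ {x₀}`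
    (∀ K : Set ℝ, IsCompact K → K ⊆ Set.Icc (-1) 1 \ {Real.cos θ₀} →
      TendstoUniformlyOn
        (fun n : ℕ => LagrangeIndex.lagrangeOp n (LagrangeIndex.stepFn (Real.cos θ₀) d))
        (LagrangeIndex.stepFn (Real.cos θ₀) d) Filter.atTop K) ∧
    -- rational case
    (∀ p q : ℕ, q ≠ 0 → Nat.gcd p q = 1 → θ₀ / Real.pi = (p : ℝ) / (q : ℝ) →
      (Odd q → ∀ m : ℕ, m < q →
        LagrangeIndex.convIndex
          (fun n => LagrangeIndex.lagrangeOp n (LagrangeIndex.stepFn (Real.cos θ₀) d)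
            (Real.cos θ₀))
          (LagrangeIndex.g ((2 * (m : ℝ) + 1) / (2 * (q : ℝ)))) = 1 / (q : ℝ)) ∧
      (Even q →
        ((∀ m : ℕ, 1 ≤ m → m < q → LagrangeIndex.g ((m : ℝ) / (q : ℝ)) ≠ d) →
          LagrangeIndex.convIndex
            (fun n => LagrangeIndex.lagrangeOp n (LagrangeIndex.stepFn (Real.cos θ₀) d)
              (Real.cos θ₀)) d = 1 / (q : ℝ)) ∧
        (∀ m : ℕ, 1 ≤ m → m < q → LagrangeIndex.g ((m : ℝ) / (q : ℝ)) ≠ d →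
          LagrangeIndex.convIndex
            (fun n => LagrangeIndex.lagrangeOp n (LagrangeIndex.stepFn (Real.cos θ₀) d)
              (Real.cos θ₀))
            (LagrangeIndex.g ((m : ℝ) / (q : ℝ))) = 1 / (q : ℝ)))) ∧
    -- irrational case
    (Irrational (θ₀ / Real.pi) → ∀ A : Set ℝ, LagrangeIndex.IsJordanMeasurable A →
      LagrangeIndex.IsJordanMeasurable (LagrangeIndex.gPreimage A) ∧
      LagrangeIndex.setConvIndex
        (fun n => LagrangeIndex.lagrangeOp n (LagrangeIndex.stepFn (Real.cos θ₀) d)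
          (Real.cos θ₀)) A
        = LagrangeIndex.jordanMeasure (LagrangeIndex.gPreimage A)) := by
  refine ⟨fun K hK hKs => LagrangeIndex.tendstoUniformlyOn_lagrangeOp_stepFn d hθ₀ hK hKs,
    fun p q hq hpq h => ⟨fun hodd m hm => ?_, fun heven => ⟨fun hd => ?_, fun m hm1 hm hd => ?_⟩⟩,
    fun hirr A hA => ⟨LagrangeIndex.isJordanMeasurable_gPreimage hA,
      LagrangeIndex.setConvIndex_lagrangeOp d hθ₀ hirr hA⟩⟩
  · exact LagrangeIndex.convIndex_lagrangeOp_of_odd hθ₀ hpq h hodd hm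
  · exact LagrangeIndex.convIndex_lagrangeOp_node_of_even hθ₀ hq hpq h heven hd
  · exact LagrangeIndex.convIndex_lagrangeOp_of_even hθ₀ hpq h heven hm1 hm hd
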